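/- Let $k=\mathbb F_q$ be a finite field of characteristic $p=2$. An Artin--Schreier curve with automorphism over $k$ is a pair $(C,\iota)$ where $C$ is a smooth projective geometrically irreducible curve over $k$ and $\iota$ is an automorphism of $C$ over $k$ of order $p$ with $C/\langle\iota\rangle\simeq\mathbb P^1_k$; two pairs are isomorphic if there is a $k$-isomorphism of the curves that is compatible with the automorphisms. Such a $C$ has an equation $y^p-y=u(x)$ with $u\in k(x)$ and $\iota:(x,y)\mapsto(x,y+1)$, where all poles of $u$ on $\mathbb P^1(\bar k)$ have order prime to $p$; the branch points are then the poles of $u$. If $e_Q$ is the order of the pole $Q$, put $\epsilon_Q=e_Q+1$. The ramification data $R$ is the multiset of the $\epsilon_Q$. The splitting behavior $S$ records, for each orbit of poles under the Frobenius $\alpha\mapsto\alpha^q$, its size (the degree of the point) and the common value of $\epsilon_Q$ on it. Define $$Z_{R,S}(q)=\sum_{[(C,\iota)]}\frac1{|\mathrm{Cent}_{\mathrm{Aut}_k(C)}\langle\iota\rangle|},$$ the (finite) sum over the $k$-isomorphism classes of Artin--Schreier curves with automorphism of type $R,S$. Let $R=\{\epsilon_1,\epsilon_2,\epsilon_3,\epsilon_4\}$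 with all $\epsilon_i$ positive and even, let $e_i=\epsilon_i-1$ and $E=\sum_{i=1}^4\left(e_i-1-\lfloor e_i/2\rfloor\right)$. If the branch locus is non-split (not all four branch points are $k$-rational), then $Z_{R,S}(q)$ is as follows. - Split/quadratic (two points of degree 1 and one of degree 2): $(q-1)^2(q^2-1)q^{E+1}/2$ if the two points of degree 1 have different pole orders, and $(q-1)^2(q^2-1)q^{E+1}/4$ if they have the same pole order. - Quadratic (two points of degree 2): $(q^2-1)^2q^E(q-2)/8$ if the two points of degree 2 have the same pole order, and $(q^2-1)^2q^E(q-2)/4$ if they have different pole orders. - Cubic (one point of degree 1 and one of degree 3): $(q-1)(q^3-1)q^E(q+1)/3$. - Quartic (one point of degree 4): $(q^4-1)q^{E+1}/4$. -/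

import Mathlib

open scoped OnePoint

universe u

namespace ArtinSchreier

noncomputable section

/-! ### Poles of rational functions on the projective line over the algebraic closure -/

/-- The points of the projective line over an algebraic closure of `k`. -/
abbrev P1bar (k : Type u) [Field k] : Type u := OnePoint (AlgebraicClosure k)

/-- The order of the pole of `f ∈ k(x)` at a geometric point of the projective line
(`0` if there is no pole there).  Numerator and denominator of `f` are coprime, so at a finite
point this is the multiplicity of the point as a root of the denominator; at `∞` it is
`deg num - deg denom` if that is positive. -/
def poleOrder {k : Type u} [Field k] (f : RatFunc k) : P1bar k → ℕ
  | ∞ => f.intDegree.toNat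
  | OnePoint.some a => (f.denom.map (algebraMap k (AlgebraicClosure k))).rootMultiplicity a

/-- The Frobenius `α ↦ α ^ q` of `k = 𝔽_q` on geometric points of the projective line. -/
def frob (k : Type u) [Field k] [Fintype k] : P1bar k → P1bar k
  | ∞ => ∞
  | OnePoint.some a => OnePoint.some (a ^ Fintype.card k)

/-- The Frobenius orbit of a geometric point, i.e. the closed point below it; the number of
its elements is the degree of that closed point. -/
def frobOrbit {k : Type u} [Field k] [Fintype k] (Q : P1bar k) : Set (P1bar k) :=
  Set.range fun n : ℕ => (frob k)^[n] Q

/-- A splitting behaviour: one entry `(ε, m)` for each Frobenius orbit of branch points, where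
`m` is the size of the orbit and `ε - 1` is the common pole order at its points.  For instance
`{(ε₁, 1), (ε₂, 1), (ε₃, 2)}` is usually written `(ε₁, ε₂, (ε₃ - ε₃))`. -/
abbrev SplittingBehavior : Type := Multiset (ℕ × ℕ)

/-- The ramification data belonging to a splitting behaviour: the multiset of the `ε_Q`, where
`Q` runs through all geometric branch points. -/
def SplittingBehavior.ramificationData (S : SplittingBehavior) : Multiset ℕ :=
  S.bind fun a => Multiset.replicate a.2 a.1

/-- The poles of `f` have splitting behaviour `S`: if `T` is a set of representatives for the
Frobenius orbits of poles, then `S` is the multiset of the pairs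
`(pole order + 1, size of the orbit)` over `T`. -/
def PolesHaveBehavior {k : Type u} [Field k] [Fintype k] (f : RatFunc k)
    (S : SplittingBehavior) : Prop :=
  ∃ T : Finset (P1bar k),
    (∀ P ∈ T, poleOrder f P ≠ 0) ∧
    (∀ Q, poleOrder f Q ≠ 0 → ∃! P, P ∈ T ∧ Q ∈ frobOrbit P) ∧
    T.val.map (fun P => (poleOrder f P + 1, (frobOrbit P).ncard)) = S

/-- `E(R) = ∑ (e_i - 1 - ⌊e_i / p⌋)` with `e_i = ε_i - 1`.  (There is no truncation when
`p ≥ 2` and all `ε_i ≥ 2`.) -/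
def exponentE (p : ℕ) (R : Multiset ℕ) : ℕ :=
  (R.map fun ε => (ε - 1) - 1 - (ε - 1) / p).sum

/-! ### Artin–Schreier curves with automorphism -/

/-- An Artin–Schreier curve with automorphism `(C, ι)` over the finite field `k` of
characteristic `p`, given by its function field: smooth projective geometrically irreducible
curves over the perfect field `k` are (contravariantly) the same as function fields of
one variable over `k` in which `k` is algebraically closed.  The automorphism `ι` has order `p`
and the quotient of `C` by `ι` is a projective line, i.e. the fixed field of `ι` is
a rational function field. -/
structure Curve (k : Type u) [Field k] (p : ℕ) where
  /-- the function field of the curve -/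
  F : Type u
  [field : Field F]
  [algebra : Algebra k F]
  /-- the action of the distinguished automorphism on functions -/
  ι : F ≃ₐ[k] F
  orderOf_ι : orderOf ι = p
  rational_quotient :
    Nonempty (RatFunc k ≃ₐ[k] IntermediateField.fixedField (Subgroup.zpowers ι))
  exact_constants : ∀ z : F, IsAlgebraic k z → z ∈ (algebraMap k F).range

attribute [instance] Curve.field Curve.algebra

namespace Curve

variable {k : Type u} [Field k] {p : ℕ}

/-- Isomorphism over `k` of Artin–Schreier curves with automorphism. -/
def Isomorphic (C₁ C₂ : Curve k p) : Prop :=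
  ∃ φ : C₁.F ≃ₐ[k] C₂.F, ∀ z, φ (C₁.ι z) = C₂.ι (φ z)

/-- The centralizer of `⟨ι⟩` in the automorphism group of the curve over `k`. -/
def cent (C : Curve k p) : Subgroup (C.F ≃ₐ[k] C.F) :=
  Subgroup.centralizer (Subgroup.zpowers C.ι : Set (C.F ≃ₐ[k] C.F))

/-- The curve has an equation `y ^ p - y = f(x)` with `ι : (x, y) ↦ (x, y + 1)`, where `x` is
a coordinate on the quotient projective line, all pole orders of `f` are prime to `p`
(so that the branch points are exactly the poles of `f`), and
the poles of `f` have splitting behaviour `S`. -/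
def HasType [Fintype k] (C : Curve k p) (S : SplittingBehavior) : Prop :=
  ∃ (x : RatFunc k ≃ₐ[k] IntermediateField.fixedField (Subgroup.zpowers C.ι))
    (f : RatFunc k) (y : C.F),
    C.ι y = y + 1 ∧ y ^ p - y = (x f : C.F) ∧
    (∀ Q, poleOrder f Q ≠ 0 → (poleOrder f Q).Coprime p) ∧
    PolesHaveBehavior f S

theorem Isomorphic.refl (C : Curve k p) : C.Isomorphic C :=
  ⟨AlgEquiv.refl, fun _ => rfl⟩

theorem Isomorphic.symm {C₁ C₂ : Curve k p} (h : C₁.Isomorphic C₂) : C₂.Isomorphic C₁ := by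
  obtain ⟨φ, hφ⟩ := h
  refine ⟨φ.symm, fun z => φ.injective ?_⟩
  rw [hφ]
  simp

theorem Isomorphic.trans {C₁ C₂ C₃ : Curve k p} (h : C₁.Isomorphic C₂)
    (h' : C₂.Isomorphic C₃) : C₁.Isomorphic C₃ := by
  obtain ⟨φ, hφ⟩ := h
  obtain ⟨ψ, hψ⟩ := h'
  exact ⟨φ.trans ψ, fun z => by simp [hφ, hψ]⟩

theorem mem_cent {C : Curve k p} {σ : C.F ≃ₐ[k] C.F} :
    σ ∈ C.cent ↔ ∀ z, σ (C.ι z) = C.ι (σ z) := by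
  have h : σ ∈ C.cent ↔ C.ι * σ = σ * C.ι := by
    rw [cent, ← Subgroup.centralizer_closure, Subgroup.zpowers_eq_closure,
      Subgroup.closure_eq, Subgroup.centralizer_closure]
    simp [Subgroup.mem_centralizer_iff]
  rw [h, AlgEquiv.ext_iff]
  exact ⟨fun H z => (H z).symm, fun H z => (H z).symm⟩

theorem Isomorphic.card_cent_eq {C₁ C₂ : Curve k p} (h : C₁.Isomorphic C₂) :
    Nat.card C₁.cent = Nat.card C₂.cent := by
  obtain ⟨φ, hφ⟩ := h
  have hφ' : ∀ z, φ.symm (C₂.ι z) = C₁.ι (φ.symm z) := fun z => φ.injective (by simp [hφ])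
  refine Nat.card_congr ((AlgEquiv.autCongr φ).toEquiv.subtypeEquiv fun σ => ?_)
  rw [mem_cent, mem_cent]
  change _ ↔ ∀ z, φ (σ (φ.symm (C₂.ι z))) = C₂.ι (φ (σ (φ.symm z)))
  constructor
  · intro H z
    rw [hφ', H, hφ]
  · intro H z
    have := H (φ z)
    rw [← hφ, ← hφ] at this
    simpa using this

/-- Isomorphism over `k`, on the Artin–Schreier curves with automorphism of a given type. -/
def isoSetoid (k : Type u) [Field k] [Fintype k] (p : ℕ) (S : SplittingBehavior) :
    Setoid {C : Curve k p // C.HasType S} where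
  r C₁ C₂ := C₁.1.Isomorphic C₂.1
  iseqv := ⟨fun C => .refl C.1, fun h => h.symm, fun h h' => h.trans h'⟩

end Curve

/-- The `k`-isomorphism classes of Artin–Schreier curves with automorphism whose cover of the
projective line has splitting behaviour `S` (and the ramification data of `S`). -/
def IsoClass (k : Type u) [Field k] [Fintype k] (p : ℕ) (S : SplittingBehavior) : Type (u + 1) :=
  Quotient (Curve.isoSetoid k p S)

/-- The weight `1 / |Cent ⟨ι⟩|` of an isomorphism class. -/
def IsoClass.weight {k : Type u} [Field k] [Fintype k] {p : ℕ} {S : SplittingBehavior}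
    (c : IsoClass k p S) : ℚ :=
  Quotient.lift (fun C : {C : Curve k p // C.HasType S} => (Nat.card C.1.cent : ℚ)⁻¹)
    (fun _ _ h => by
      have := Curve.Isomorphic.card_cent_eq h
      simp only [this]) c

/-- The mass `Z_{R,S}(q)`, where `R` is the ramification data of `S`. -/
def mass (k : Type u) [Field k] [Fintype k] (p : ℕ) (S : SplittingBehavior) : ℚ :=
  ∑ᶠ c : IsoClass k p S, c.weight

end

end ArtinSchreier

/-! The mass is a groupoid count, so it reduces to counting equations. A `Frame` of a curve is a
coordinate `x` on the quotient line together with a generator `y` satisfying `ι y = y + 1`; it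
yields the equation `y ^ 2 - y = f(x)`. Any two frames of one curve differ by a unique pair `(σ,
h)`, with `σ` an automorphism of `k(x)` and `h ∈ k(x)`, and the equation changes by `σ` and by
adding `h ^ 2 - h` (`Frame.change_bijective`, `Frame.change_func`).

Let `D` be the pole divisor of `f`. Since `h ^ 2 - h` has poles of exactly twice the order of those
of `h`, all pole orders stay odd precisely when `h` has poles at most `⌊D/2⌋`
(`add_sq_sub_self_mem_typeSet_iff`). So each curve of type `S` has `(q ^ 3 - q) * q ^ (deg ⌊D/2⌋ +
1)` admissible frames, a number depending only on `S`. The frames with one fixed equation are a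
torsor under the centralizer of `ι`. Hence the mass times this number is the number of functions
with poles of type `S` (`mass_mul_changeCount`).

That number is a sum over divisors. Each `D` is the pole divisor of `q ^ (deg D + 1) * ∏ (1 - q ^
(-deg P))` functions (`ncard_poleDiv_eq`), by Riemann-Roch on the line and inclusion-exclusion. As
`deg D - deg ⌊D/2⌋ = E + 4` (`sum_degrees_eq`), what remains is the number of divisors with labels
`S`: tuples of distinct closed points of given degrees, divided by the symmetries of the labels
(`ncard_pointTuples_eq`). The closed points of each degree are counted by the fixed points of powers
of Frobenius. -/

namespace ArtinSchreier

open Polynomial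

/-! ### Frobenius orbits on the projective line -/

section ClosedPoints

variable {k : Type u} [Field k] [Fintype k]

@[simp] theorem frob_infty : frob k ∞ = ∞ := rfl

@[simp] theorem frob_some (a : AlgebraicClosure k) :
    frob k (a : P1bar k) = ((a ^ Fintype.card k : AlgebraicClosure k) : P1bar k) := rfl

theorem iterate_frob_infty (n : ℕ) : (frob k)^[n] ∞ = ∞ :=
  Function.iterate_fixed frob_infty n

theorem iterate_frob_some (n : ℕ) (a : AlgebraicClosure k) :
    (frob k)^[n] (a : P1bar k) = ((a ^ Fintype.card k ^ n : AlgebraicClosure k) : P1bar k) := by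
  induction n with
  | zero => simp
  | succ n ih => rw [Function.iterate_succ_apply', ih, frob_some, ← pow_mul, pow_succ]

/-- The element lies in the finite field `k(a)`, whose order is a power of that of `k`. -/
theorem exists_pow_card_pow_eq (a : AlgebraicClosure k) :
    ∃ n, 0 < n ∧ a ^ Fintype.card k ^ n = a := by
  have hint : IsIntegral k a := (Algebra.IsAlgebraic.isAlgebraic a).isIntegral
  have := IntermediateField.adjoin.finiteDimensional hint
  have : Finite (IntermediateField.adjoin k {a}) := Module.finite_of_finite k
  have := Fintype.ofFinite (IntermediateField.adjoin k {a})
  refine ⟨Module.finrank k (IntermediateField.adjoin k {a}), Module.finrank_pos, ?_⟩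
  rw [← Module.card_eq_pow_finrank]
  have := FiniteField.pow_card (⟨a, IntermediateField.mem_adjoin_simple_self k a⟩ :
    IntermediateField.adjoin k {a})
  simpa using congrArg Subtype.val this

theorem mem_periodicPts_frob (Q : P1bar k) : Q ∈ Function.periodicPts (frob k) := by
  induction Q using OnePoint.rec with
  | infty => exact ⟨1, one_pos, frob_infty⟩
  | coe a =>
    obtain ⟨n, hn, h⟩ := exists_pow_card_pow_eq a
    exact ⟨n, hn, by rw [Function.IsPeriodicPt, Function.IsFixedPt, iterate_frob_some, h]⟩

theorem minimalPeriod_frob_pos (Q : P1bar k) : 0 < Function.minimalPeriod (frob k) Q :=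
  Function.minimalPeriod_pos_of_mem_periodicPts (mem_periodicPts_frob Q)

theorem frobOrbit_eq_image (Q : P1bar k) :
    frobOrbit Q = (fun n => (frob k)^[n] Q) '' Set.Iio (Function.minimalPeriod (frob k) Q) := by
  ext P
  constructor
  · rintro ⟨n, rfl⟩
    exact ⟨n % _, Nat.mod_lt _ (minimalPeriod_frob_pos Q), Function.iterate_mod_minimalPeriod_eq⟩
  · rintro ⟨n, -, rfl⟩
    exact ⟨n, rfl⟩

theorem finite_frobOrbit (Q : P1bar k) : (frobOrbit Q).Finite := by
  rw [frobOrbit_eq_image]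
  exact (Set.finite_Iio _).image _

theorem ncard_frobOrbit (Q : P1bar k) :
    (frobOrbit Q).ncard = Function.minimalPeriod (frob k) Q := by
  rw [frobOrbit_eq_image, Set.InjOn.ncard_image, Set.ncard_eq_toFinset_card']
  · simp
  · intro m hm n hn h
    exact (Function.iterate_eq_iterate_iff_of_lt_minimalPeriod hm hn).1 h

theorem mem_frobOrbit_self (Q : P1bar k) : Q ∈ frobOrbit Q := ⟨0, rfl⟩

theorem frobOrbit_eq_of_mem {P Q : P1bar k} (h : P ∈ frobOrbit Q) : frobOrbit P = frobOrbit Q := by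
  obtain ⟨n, rfl⟩ := h
  ext R
  constructor
  · rintro ⟨m, rfl⟩
    exact ⟨m + n, Function.iterate_add_apply _ _ _ _⟩
  · rintro ⟨m, rfl⟩
    have hp := minimalPeriod_frob_pos Q
    -- Completing the `n` steps already made to `n` full periods leads back to `Q`.
    have h1 : (frob k)^[m + n * (Function.minimalPeriod (frob k) Q - 1)] ((frob k)^[n] Q)
        = (frob k)^[m] Q := by
      rw [← Function.iterate_add_apply]
      have : m + n * (Function.minimalPeriod (frob k) Q - 1) + n
          = m + Function.minimalPeriod (frob k) Q * n := by
        obtain ⟨c, hc⟩ := Nat.exists_eq_succ_of_ne_zero hp.ne'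
        rw [hc]; simp; ring
      rw [this, Function.iterate_add_apply]
      congr 1
      exact (Function.isPeriodicPt_minimalPeriod (frob k) Q).mul_const n
    exact ⟨_, h1⟩

theorem mem_frobOrbit_iff {P Q : P1bar k} : P ∈ frobOrbit Q ↔ frobOrbit P = frobOrbit Q :=
  ⟨frobOrbit_eq_of_mem, fun h => h ▸ mem_frobOrbit_self P⟩

theorem frobOrbit_frob (Q : P1bar k) : frobOrbit (frob k Q) = frobOrbit Q :=
  frobOrbit_eq_of_mem ⟨1, rfl⟩

theorem frobOrbit_infty : frobOrbit (∞ : P1bar k) = {∞} := by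
  ext P
  constructor
  · rintro ⟨n, rfl⟩
    exact iterate_frob_infty n
  · rintro rfl
    exact mem_frobOrbit_self _

/-- The polynomial `X ^ (q ^ n) - X` is separable and splits, so it has as many roots as its degree.
-/
theorem ncard_pow_card_pow_eq {n : ℕ} (hn : n ≠ 0) :
    {a : AlgebraicClosure k | a ^ Fintype.card k ^ n = a}.ncard = Fintype.card k ^ n := by
  classical
  obtain ⟨p, hp⟩ := CharP.exists k
  have : Fact p.Prime := ⟨CharP.char_is_prime k p⟩
  have : CharP (AlgebraicClosure k) p := charP_of_injective_algebraMap' k p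
  have hq : p ∣ Fintype.card k ^ n := by
    obtain ⟨m, -, hm⟩ := FiniteField.card k p
    rw [hm]
    exact dvd_pow (dvd_pow_self _ m.ne_zero) hn
  have hsep := galois_poly_separable (K := AlgebraicClosure k) p (Fintype.card k ^ n) hq
  have hdeg := FiniteField.X_pow_card_pow_sub_X_natDegree_eq (AlgebraicClosure k) hn
    (Fintype.one_lt_card (α := k))
  have h0 := hsep.ne_zero
  have hset : {a : AlgebraicClosure k | a ^ Fintype.card k ^ n = a}
      = ((X ^ Fintype.card k ^ n - X : (AlgebraicClosure k)[X]).roots.toFinset :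
        Set (AlgebraicClosure k)) := by
    ext a
    simp [mem_roots h0, sub_eq_zero]
  rw [hset, Set.ncard_coe_finset, Multiset.toFinset_card_of_nodup (nodup_roots hsep),
    splits_iff_card_roots.1 (IsAlgClosed.splits _), hdeg]

/-- The image of `k` is contained in the set of solutions of `a ^ q = a`, and both have `q`
elements. This is what descends polynomials from the algebraic closure to `k`. -/
theorem mem_range_algebraMap_of_pow_card_eq {a : AlgebraicClosure k}
    (h : a ^ Fintype.card k = a) : a ∈ Set.range (algebraMap k (AlgebraicClosure k)) := by
  have hc := ncard_pow_card_pow_eq (k := k) one_ne_zero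
  have hfin : {a : AlgebraicClosure k | a ^ Fintype.card k ^ 1 = a}.Finite :=
    Set.finite_of_ncard_ne_zero (by rw [hc]; simp)
  have : Set.range (algebraMap k (AlgebraicClosure k))
      = {a : AlgebraicClosure k | a ^ Fintype.card k ^ 1 = a} := by
    refine Set.eq_of_subset_of_ncard_le ?_ ?_ hfin
    · rintro _ ⟨c, rfl⟩
      simp [← map_pow, FiniteField.pow_card]
    · rw [hc, ← Set.image_univ, Set.ncard_image_of_injective _ (algebraMap k _).injective,
        Set.ncard_univ]
      simp
  rw [this]
  simpa using h

theorem finite_isPeriodicPt_frob {n : ℕ} (hn : n ≠ 0) :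
    {Q : P1bar k | Function.IsPeriodicPt (frob k) n Q}.Finite ∧
    {Q : P1bar k | Function.IsPeriodicPt (frob k) n Q}.ncard = Fintype.card k ^ n + 1 := by
  have hc := ncard_pow_card_pow_eq (k := k) hn
  have hfin : {a : AlgebraicClosure k | a ^ Fintype.card k ^ n = a}.Finite :=
    Set.finite_of_ncard_ne_zero (by rw [hc]; simp)
  have hset : {Q : P1bar k | Function.IsPeriodicPt (frob k) n Q}
      = insert ∞ ((fun a : AlgebraicClosure k => (a : P1bar k)) ''
        {a : AlgebraicClosure k | a ^ Fintype.card k ^ n = a}) := by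
    ext Q
    induction Q using OnePoint.rec with
    | infty => simp [Function.IsPeriodicPt, Function.IsFixedPt, iterate_frob_infty]
    | coe a => simp [Function.IsPeriodicPt, Function.IsFixedPt, iterate_frob_some]
  rw [hset]
  refine ⟨(hfin.image _).insert _, ?_⟩
  rw [Set.ncard_insert_of_notMem (by simp) (hfin.image _),
    Set.ncard_image_of_injective _ OnePoint.coe_injective, hc]

variable (k) in
/-- The closed points of the projective line: Frobenius orbits of geometric points. -/
def ClosedPoint : Type u := Set.range (frobOrbit (k := k))

namespace ClosedPoint

/-- The closed point below a geometric point. -/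
def mk (Q : P1bar k) : ClosedPoint k := ⟨frobOrbit Q, Q, rfl⟩

theorem mk_surjective : Function.Surjective (mk (k := k)) := by
  rintro ⟨_, Q, rfl⟩
  exact ⟨Q, rfl⟩

/-- A geometric point above a closed point. -/
noncomputable def rep (o : ClosedPoint k) : P1bar k := (mk_surjective o).choose

@[simp] theorem mk_rep (o : ClosedPoint k) : mk o.rep = o := (mk_surjective o).choose_spec

theorem mk_eq_mk_iff {P Q : P1bar k} : mk P = mk Q ↔ frobOrbit P = frobOrbit Q :=
  Subtype.ext_iff

theorem mk_eq_mk_iff_mem {P Q : P1bar k} : mk P = mk Q ↔ P ∈ frobOrbit Q := by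
  rw [mk_eq_mk_iff, mem_frobOrbit_iff]

/-- The geometric points above a closed point. -/
def pts (o : ClosedPoint k) : Set (P1bar k) := o.1

@[simp] theorem pts_mk (Q : P1bar k) : (mk Q).pts = frobOrbit Q := rfl

theorem finite_pts (o : ClosedPoint k) : o.pts.Finite := by
  obtain ⟨P, rfl⟩ := mk_surjective o
  exact finite_frobOrbit P

theorem mem_pts_iff {o : ClosedPoint k} {Q : P1bar k} : Q ∈ o.pts ↔ mk Q = o := by
  obtain ⟨P, rfl⟩ := mk_surjective o
  rw [mk_eq_mk_iff_mem, pts_mk]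

/-- The degree of a closed point. -/
noncomputable def deg (o : ClosedPoint k) : ℕ := o.pts.ncard

theorem deg_mk (Q : P1bar k) : (mk Q).deg = (frobOrbit Q).ncard := rfl

theorem deg_mk_eq_minimalPeriod (Q : P1bar k) :
    (mk Q).deg = Function.minimalPeriod (frob k) Q := ncard_frobOrbit Q

theorem deg_pos (o : ClosedPoint k) : 0 < o.deg := by
  obtain ⟨Q, rfl⟩ := mk_surjective o
  rw [deg_mk_eq_minimalPeriod]
  exact minimalPeriod_frob_pos Q

theorem finite_setOf_deg_eq (d : ℕ) : {o : ClosedPoint k | o.deg = d}.Finite := by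
  rcases Nat.eq_zero_or_pos d with rfl | hd
  · convert Set.finite_empty
    ext o
    simpa using o.deg_pos.ne'
  refine ((finite_isPeriodicPt_frob (k := k) hd.ne').1.image mk).subset ?_
  intro o ho
  obtain ⟨Q, rfl⟩ := mk_surjective o
  refine ⟨Q, ?_, rfl⟩
  rw [Set.mem_ofPred_eq, Function.isPeriodicPt_iff_minimalPeriod_dvd, ← deg_mk_eq_minimalPeriod]
  exact dvd_of_eq ho

theorem ncard_setOf_minimalPeriod_eq (d : ℕ) :
    {Q : P1bar k | Function.minimalPeriod (frob k) Q = d}.ncard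
      = d * {o : ClosedPoint k | o.deg = d}.ncard := by
  classical
  have hfin := finite_setOf_deg_eq (k := k) d
  have hset : {Q : P1bar k | Function.minimalPeriod (frob k) Q = d}
      = ((hfin.toFinset.biUnion fun o => o.finite_pts.toFinset : Finset (P1bar k)) :
        Set (P1bar k)) := by
    ext Q
    simp [mem_pts_iff, ← deg_mk_eq_minimalPeriod]
  rw [hset, Set.ncard_coe_finset, Set.ncard_eq_toFinset_card _ hfin, Finset.card_biUnion,
    Finset.sum_const_nat (m := d), mul_comm]
  · intro o ho
    rw [Set.Finite.mem_toFinset] at ho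
    rw [← Set.ncard_eq_toFinset_card _ o.finite_pts]
    exact ho
  · intro o _ o' _ hne
    refine Finset.disjoint_left.2 fun Q hQ hQ' => ?_
    rw [Set.Finite.mem_toFinset, mem_pts_iff] at hQ hQ'
    exact hne (hQ.symm.trans hQ')

/-- Counting the geometric points fixed by a power of Frobenius. -/
theorem sum_divisors_mul_ncard {n : ℕ} (hn : n ≠ 0) :
    ∑ d ∈ n.divisors, d * {o : ClosedPoint k | o.deg = d}.ncard = Fintype.card k ^ n + 1 := by
  classical
  obtain ⟨hfin, hcard⟩ := finite_isPeriodicPt_frob (k := k) hn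
  rw [← hcard, Set.ncard_eq_toFinset_card _ hfin,
    Finset.card_eq_sum_card_fiberwise (f := fun Q => Function.minimalPeriod (frob k) Q)
      (t := n.divisors)]
  · refine Finset.sum_congr rfl fun d hd => ?_
    rw [← ncard_setOf_minimalPeriod_eq, ← Set.ncard_coe_finset]
    congr 1
    ext Q
    simp only [Set.mem_ofPred_eq, Finset.coe_filter, Set.Finite.mem_toFinset,
      Function.isPeriodicPt_iff_minimalPeriod_dvd]
    constructor
    · rintro rfl
      exact ⟨Nat.dvd_of_mem_divisors hd, rfl⟩
    · exact fun h => h.2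
  · intro Q hQ
    simp only [Finset.mem_coe, Set.Finite.mem_toFinset, Set.mem_ofPred_eq,
      Function.isPeriodicPt_iff_minimalPeriod_dvd] at hQ ⊢
    exact Nat.mem_divisors.2 ⟨hQ, hn⟩

variable (k) in
/-- The number of closed points of degree `d`. -/
noncomputable def count (d : ℕ) : ℕ := {o : ClosedPoint k | o.deg = d}.ncard

theorem count_one : count k 1 = Fintype.card k + 1 := by
  have := sum_divisors_mul_ncard (k := k) one_ne_zero
  simpa [count] using this

theorem count_two : 2 * count k 2 + Fintype.card k = Fintype.card k ^ 2 := by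
  have := sum_divisors_mul_ncard (k := k) two_ne_zero
  rw [Nat.prime_two.sum_divisors] at this
  have h1 := count_one (k := k)
  simp only [count] at *
  omega

theorem count_three : 3 * count k 3 + Fintype.card k = Fintype.card k ^ 3 := by
  have := sum_divisors_mul_ncard (k := k) three_ne_zero
  rw [Nat.prime_three.sum_divisors] at this
  have h1 := count_one (k := k)
  simp only [count] at *
  omega

theorem count_four : 4 * count k 4 + Fintype.card k ^ 2 = Fintype.card k ^ 4 := by
  have := sum_divisors_mul_ncard (k := k) four_ne_zero
  -- The points of degree 1 and 2 together account for the `q ^ 2 + 1` fixed points of the second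
  -- power of Frobenius.
  rw [show Nat.divisors 4 = {1, 2, 4} by decide] at this
  have h1 := count_one (k := k)
  have h2 := count_two (k := k)
  simp [count] at *
  omega

end ClosedPoint

end ClosedPoints

/-! ### Orders of rational functions at points of the projective line -/

section Orders

variable {k : Type u} [Field k]

/-- The order of vanishing of a polynomial at a geometric point of the projective line. -/
noncomputable def polyOrd (A : k[X]) : P1bar k → ℤ
  | ∞ => -(A.natDegree : ℤ)
  | OnePoint.some a => ((A.map (algebraMap k (AlgebraicClosure k))).rootMultiplicity a : ℤ)

theorem polyOrd_infty (A : k[X]) : polyOrd A ∞ = -(A.natDegree : ℤ) := rfl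

theorem polyOrd_some (A : k[X]) (a : AlgebraicClosure k) :
    polyOrd A (a : P1bar k) =
      ((A.map (algebraMap k (AlgebraicClosure k))).rootMultiplicity a : ℤ) := rfl

theorem polyOrd_mul {A B : k[X]} (hA : A ≠ 0) (hB : B ≠ 0) (Q : P1bar k) :
    polyOrd (A * B) Q = polyOrd A Q + polyOrd B Q := by
  induction Q using OnePoint.rec with
  | infty =>
    rw [polyOrd_infty, polyOrd_infty, polyOrd_infty, natDegree_mul hA hB]
    push_cast; ring
  | coe a =>
    rw [polyOrd_some, polyOrd_some, polyOrd_some, Polynomial.map_mul, rootMultiplicity_mul]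
    · push_cast; rfl
    · exact mul_ne_zero (Polynomial.map_ne_zero hA) (Polynomial.map_ne_zero hB)

theorem polyOrd_add {A B : k[X]} (hAB : A + B ≠ 0) (Q : P1bar k) :
    min (polyOrd A Q) (polyOrd B Q) ≤ polyOrd (A + B) Q := by
  induction Q using OnePoint.rec with
  | infty =>
    have := natDegree_add_le A B
    simp only [polyOrd_infty]
    omega
  | coe a =>
    rw [polyOrd_some, polyOrd_some, polyOrd_some, Polynomial.map_add]
    exact_mod_cast rootMultiplicity_add a
      (by rw [← Polynomial.map_add]; exact Polynomial.map_ne_zero hAB)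

/-- The order of vanishing of a rational function at a geometric point. -/
noncomputable def ord (f : RatFunc k) (Q : P1bar k) : ℤ := polyOrd f.num Q - polyOrd f.denom Q

/-- Cross-multiplication and additivity of `polyOrd` make the order independent of the fraction
chosen, so later computations need no reduced form. -/
theorem ord_div {A B : k[X]} (hA : A ≠ 0) (hB : B ≠ 0) (Q : P1bar k) :
    ord (algebraMap k[X] (RatFunc k) A / algebraMap k[X] (RatFunc k) B) Q
      = polyOrd A Q - polyOrd B Q := by
  set f := algebraMap k[X] (RatFunc k) A / algebraMap k[X] (RatFunc k) B with hf
  have hf0 : f ≠ 0 := div_ne_zero (RatFunc.algebraMap_ne_zero hA) (RatFunc.algebraMap_ne_zero hB)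
  have h : f.num * B = A * f.denom := (RatFunc.num_mul_eq_mul_denom_iff hB).2 hf
  have h1 := polyOrd_mul (RatFunc.num_ne_zero hf0) hB Q
  rw [h, polyOrd_mul hA f.denom_ne_zero] at h1
  rw [ord]
  omega

theorem ord_mul {f g : RatFunc k} (hf : f ≠ 0) (hg : g ≠ 0) (Q : P1bar k) :
    ord (f * g) Q = ord f Q + ord g Q := by
  have h : f * g = algebraMap k[X] (RatFunc k) (f.num * g.num) /
      algebraMap k[X] (RatFunc k) (f.denom * g.denom) := by
    rw [map_mul, map_mul, mul_div_mul_comm, RatFunc.num_div_denom, RatFunc.num_div_denom]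
  have hf' := RatFunc.num_ne_zero hf
  have hg' := RatFunc.num_ne_zero hg
  rw [h, ord_div (mul_ne_zero hf' hg') (mul_ne_zero f.denom_ne_zero g.denom_ne_zero),
    polyOrd_mul hf' hg', polyOrd_mul f.denom_ne_zero g.denom_ne_zero, ord, ord]
  ring

theorem ord_add {f g : RatFunc k} (hf : f ≠ 0) (hg : g ≠ 0) (hfg : f + g ≠ 0) (Q : P1bar k) :
    min (ord f Q) (ord g Q) ≤ ord (f + g) Q := by
  have hf' := RatFunc.num_ne_zero hf
  have hg' := RatFunc.num_ne_zero hg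
  have hd := RatFunc.algebraMap_ne_zero f.denom_ne_zero
  have hd' := RatFunc.algebraMap_ne_zero g.denom_ne_zero
  have h : f + g = algebraMap k[X] (RatFunc k) (f.num * g.denom + f.denom * g.num) /
      algebraMap k[X] (RatFunc k) (f.denom * g.denom) := by
    conv_lhs => rw [← RatFunc.num_div_denom f, ← RatFunc.num_div_denom g]
    rw [div_add_div _ _ hd hd']
    simp only [map_mul, map_add]
  have hn := RatFunc.num_mul_denom_add_denom_mul_num_ne_zero hfg
  have := polyOrd_add hn Q
  rw [h, ord_div hn (mul_ne_zero f.denom_ne_zero g.denom_ne_zero)]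
  rw [polyOrd_mul hf' g.denom_ne_zero, polyOrd_mul f.denom_ne_zero hg'] at this
  rw [polyOrd_mul f.denom_ne_zero g.denom_ne_zero, ord, ord]
  omega

@[simp] theorem poleOrder_zero (Q : P1bar k) : poleOrder (0 : RatFunc k) Q = 0 := by
  induction Q using OnePoint.rec with
  | infty => exact congrArg Int.toNat RatFunc.intDegree_zero
  | coe a => simp [poleOrder]

theorem poleOrder_infty (f : RatFunc k) : poleOrder f ∞ = f.intDegree.toNat := rfl

theorem poleOrder_some (f : RatFunc k) (a : AlgebraicClosure k) : poleOrder f (a : P1bar k) =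
    (f.denom.map (algebraMap k (AlgebraicClosure k))).rootMultiplicity a := rfl

/-- Numerator and denominator are coprime, so at most one of them vanishes at a finite point. The
formula also covers `f = 0`, whose `ord` takes the default value 0. -/
theorem poleOrder_eq_toNat (f : RatFunc k) (Q : P1bar k) :
    poleOrder f Q = (-ord f Q).toNat := by
  induction Q using OnePoint.rec with
  | infty =>
    rw [poleOrder_infty, ord, polyOrd_infty, polyOrd_infty, RatFunc.intDegree]
    congr 1
    ring
  | coe a =>
    rw [poleOrder_some, ord, polyOrd_some, polyOrd_some]
    have hc : IsCoprime (f.num.map (algebraMap k (AlgebraicClosure k)))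
        (f.denom.map (algebraMap k (AlgebraicClosure k))) :=
      f.isCoprime_num_denom.map (mapRingHom (algebraMap k (AlgebraicClosure k)))
    have : rootMultiplicity a (f.num.map (algebraMap k (AlgebraicClosure k))) = 0 ∨
        rootMultiplicity a (f.denom.map (algebraMap k (AlgebraicClosure k))) = 0 := by
      by_contra! h
      have h1 := (rootMultiplicity_pos' .. |>.1 (Nat.pos_of_ne_zero h.1)).2
      have h2 := (rootMultiplicity_pos' .. |>.1 (Nat.pos_of_ne_zero h.2)).2
      obtain ⟨u, v, huv⟩ := hc
      have := congrArg (eval a) huv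
      rw [IsRoot.def] at h1 h2
      simp [h1, h2] at this
    omega

theorem poleOrder_add_le (f g : RatFunc k) (Q : P1bar k) :
    poleOrder (f + g) Q ≤ max (poleOrder f Q) (poleOrder g Q) := by
  rcases eq_or_ne f 0 with rfl | hf
  · simp
  rcases eq_or_ne g 0 with rfl | hg
  · simp
  rcases eq_or_ne (f + g) 0 with hfg | hfg
  · simp [hfg]
  have := ord_add hf hg hfg Q
  rw [poleOrder_eq_toNat, poleOrder_eq_toNat, poleOrder_eq_toNat]
  omega

theorem poleOrder_neg (f : RatFunc k) (Q : P1bar k) : poleOrder (-f) Q = poleOrder f Q := by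
  have key : ∀ g : RatFunc k, poleOrder (-g) Q ≤ poleOrder g Q := by
    intro g
    rcases eq_or_ne g 0 with rfl | hg
    · simp
    have h1 : (-1 : RatFunc k) ≠ 0 := neg_ne_zero.2 one_ne_zero
    -- The constant `-1` has order 0 everywhere because its square is 1.
    have h2 := ord_mul h1 h1 Q
    have h3 := ord_mul (one_ne_zero (α := RatFunc k)) one_ne_zero Q
    have h4 := ord_mul h1 hg Q
    rw [neg_one_mul] at h4
    rw [neg_one_mul, neg_neg] at h2
    rw [one_mul] at h3
    rw [poleOrder_eq_toNat, poleOrder_eq_toNat]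
    omega
  refine le_antisymm (key f) ?_
  simpa using key (-f)

/-- The strict ultrametric equality: subtracting `g` again shows that no cancellation can occur. -/
theorem poleOrder_add_eq_left {f g : RatFunc k} {Q : P1bar k}
    (h : poleOrder g Q < poleOrder f Q) : poleOrder (f + g) Q = poleOrder f Q := by
  have h1 := poleOrder_add_le f g Q
  have h2 := poleOrder_add_le (f + g) (-g) Q
  rw [add_neg_cancel_right, poleOrder_neg] at h2
  omega

theorem poleOrder_sq (f : RatFunc k) (Q : P1bar k) :
    poleOrder (f ^ 2) Q = 2 * poleOrder f Q := by
  rcases eq_or_ne f 0 with rfl | hf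
  · simp
  rw [poleOrder_eq_toNat, poleOrder_eq_toNat, pow_two, ord_mul hf hf]
  omega

theorem poleOrder_C (c : k) (Q : P1bar k) : poleOrder (RatFunc.C c) Q = 0 := by
  induction Q using OnePoint.rec with
  | infty => rw [poleOrder_infty, RatFunc.intDegree_C]; rfl
  | coe a => rw [poleOrder_some, RatFunc.denom_C, Polynomial.map_one]; exact rootMultiplicity_C 1 a

/-- At a pole of `h` the square dominates. Thus a change of the Artin-Schreier generator only
introduces poles of even order. -/
theorem poleOrder_sq_sub_self (h : RatFunc k) (Q : P1bar k) :
    poleOrder (h ^ 2 - h) Q = 2 * poleOrder h Q := by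
  rcases Nat.eq_zero_or_pos (poleOrder h Q) with h0 | h0
  · have := poleOrder_add_le (h ^ 2) (-h) Q
    rw [← sub_eq_add_neg, poleOrder_sq, poleOrder_neg] at this
    omega
  · rw [sub_eq_add_neg, poleOrder_add_eq_left, poleOrder_sq]
    rw [poleOrder_sq, poleOrder_neg]
    omega

theorem finite_setOf_poleOrder_ne_zero (f : RatFunc k) : {Q | poleOrder f Q ≠ 0}.Finite := by
  classical
  refine (((f.denom.map (algebraMap k (AlgebraicClosure k))).roots.toFinset.finite_toSet.image
    (fun a : AlgebraicClosure k => (a : P1bar k))).insert ∞).subset ?_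
  intro Q hQ
  induction Q using OnePoint.rec with
  | infty => exact Set.mem_insert _ _
  | coe a =>
    refine Set.mem_insert_of_mem _ ⟨a, ?_, rfl⟩
    rw [Finset.mem_coe, Multiset.mem_toFinset, ← Multiset.count_pos, count_roots]
    exact Nat.pos_of_ne_zero hQ

end Orders

/-! ### Divisors of poles and Riemann-Roch spaces -/

section Divisors

variable {k : Type u} [Field k] [Fintype k]

/-- Frobenius is an injective `k`-algebra map, so it fixes the coefficients of `A` and preserves
multiplicities of roots. -/
theorem rootMultiplicity_pow_card (A : k[X]) (a : AlgebraicClosure k) :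
    (A.map (algebraMap k (AlgebraicClosure k))).rootMultiplicity (a ^ Fintype.card k)
      = (A.map (algebraMap k (AlgebraicClosure k))).rootMultiplicity a := by
  set σ : AlgebraicClosure k →ₐ[k] AlgebraicClosure k :=
    FiniteField.frobeniusAlgHom k (AlgebraicClosure k)
  have h := eq_rootMultiplicity_map (p := A.map (algebraMap k (AlgebraicClosure k)))
    (f := (σ : AlgebraicClosure k →+* AlgebraicClosure k)) σ.toRingHom.injective a
  rw [Polynomial.map_map, AlgHom.comp_algebraMap] at h
  exact h.symm

theorem poleOrder_frob (f : RatFunc k) (Q : P1bar k) : poleOrder f (frob k Q) = poleOrder f Q := by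
  induction Q using OnePoint.rec with
  | infty => rfl
  | coe a => exact rootMultiplicity_pow_card f.denom a

theorem poleOrder_eq_of_mem_frobOrbit (f : RatFunc k) {P Q : P1bar k} (h : P ∈ frobOrbit Q) :
    poleOrder f P = poleOrder f Q := by
  obtain ⟨n, rfl⟩ := h
  induction n with
  | zero => rfl
  | succ n ih =>
    refine Eq.trans ?_ ih
    dsimp only
    rw [Function.iterate_succ_apply', poleOrder_frob]

/-- The divisor of poles of a rational function. -/
noncomputable def poleDiv (f : RatFunc k) : ClosedPoint k →₀ ℕ :=
  Finsupp.ofSupportFinite (fun o => poleOrder f o.rep) <| by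
    refine ((finite_setOf_poleOrder_ne_zero f).image ClosedPoint.mk).subset ?_
    intro o ho
    exact ⟨o.rep, ho, o.mk_rep⟩

theorem poleDiv_mk (f : RatFunc k) (Q : P1bar k) :
    poleDiv f (ClosedPoint.mk Q) = poleOrder f Q :=
  poleOrder_eq_of_mem_frobOrbit f (ClosedPoint.mk_eq_mk_iff_mem.1 (ClosedPoint.mk_rep _))

theorem poleDiv_apply (f : RatFunc k) (o : ClosedPoint k) : poleDiv f o = poleOrder f o.rep := rfl

/-- The degree of a divisor. -/
noncomputable def divDeg (D : ClosedPoint k →₀ ℕ) : ℕ := D.sum fun o n => n * o.deg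

theorem divDeg_add (D D' : ClosedPoint k →₀ ℕ) : divDeg (D + D') = divDeg D + divDeg D' :=
  Finsupp.sum_add_index' (fun _ => zero_mul _) (fun _ _ _ => add_mul _ _ _)

@[simp] theorem divDeg_single (o : ClosedPoint k) (n : ℕ) :
    divDeg (Finsupp.single o n) = n * o.deg :=
  Finsupp.sum_single_index (zero_mul _)

/-- Frobenius permutes the set `s`, hence fixes the product and all its coefficients, which
therefore lie in `k`. -/
theorem exists_map_eq_prod_X_sub_C (s : Finset (AlgebraicClosure k))
    (hs : ∀ a ∈ s, a ^ Fintype.card k ∈ s) :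
    ∃ m : k[X], m.map (algebraMap k (AlgebraicClosure k)) = ∏ a ∈ s, (X - C a) := by
  classical
  set σ : AlgebraicClosure k →ₐ[k] AlgebraicClosure k :=
    FiniteField.frobeniusAlgHom k (AlgebraicClosure k)
  have hσ : Function.Injective σ := σ.toRingHom.injective
  have himg : s.image σ = s := by
    refine Finset.eq_of_subset_of_card_le ?_ ?_
    · intro b hb
      obtain ⟨a, ha, rfl⟩ := Finset.mem_image.1 hb
      exact hs a ha
    · rw [Finset.card_image_of_injective _ hσ]
  have hmap : (∏ a ∈ s, (X - C a)).map (σ : AlgebraicClosure k →+* AlgebraicClosure k)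
      = ∏ a ∈ s, (X - C a) := by
    conv_rhs => rw [← himg, Finset.prod_image (fun a _ b _ h => hσ h)]
    rw [Polynomial.map_prod]
    refine Finset.prod_congr rfl fun a _ => ?_
    simp
  have hl : (∏ a ∈ s, (X - C a)) ∈ lifts (algebraMap k (AlgebraicClosure k)) := by
    rw [lifts_iff_coeff_lifts]
    intro n
    refine mem_range_algebraMap_of_pow_card_eq ?_
    conv_rhs => rw [← hmap, coeff_map]
    rfl
  obtain ⟨m, hm⟩ := hl
  exact ⟨m, hm⟩

open Classical in
-- The product of `X - a` over the finite points of the orbit. For the point at infinity the product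
-- is empty, whence the degree 0.
theorem ClosedPoint.exists_poly (o : ClosedPoint k) :
    ∃ m : k[X], m ≠ 0 ∧ m.natDegree = (if o = mk ∞ then 0 else o.deg) ∧
      ∀ a : AlgebraicClosure k, (m.map (algebraMap k (AlgebraicClosure k))).rootMultiplicity a =
        if o = mk (a : P1bar k) then 1 else 0 := by
  have hfin : {a : AlgebraicClosure k | (a : P1bar k) ∈ o.pts}.Finite :=
    o.finite_pts.preimage (OnePoint.coe_injective.injOn)
  obtain ⟨m, hm⟩ := exists_map_eq_prod_X_sub_C hfin.toFinset (by
    intro a ha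
    rw [Set.Finite.mem_toFinset, Set.mem_ofPred_eq, mem_pts_iff] at ha ⊢
    rw [← ha, ← frob_some, mk_eq_mk_iff, frobOrbit_frob])
  refine ⟨m, ?_, ?_, ?_⟩
  · rintro rfl
    rw [Polynomial.map_zero] at hm
    exact Finset.prod_ne_zero_iff.2 (fun a _ => X_sub_C_ne_zero a) hm.symm
  · rw [← natDegree_map (algebraMap k (AlgebraicClosure k)), hm, natDegree_prod_of_monic _ _
      (fun a _ => monic_X_sub_C a)]
    simp only [natDegree_X_sub_C, Finset.sum_const, smul_eq_mul, mul_one]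
    split_ifs with h
    · rw [Finset.card_eq_zero, Finset.eq_empty_iff_forall_notMem]
      intro a ha
      rw [Set.Finite.mem_toFinset, Set.mem_ofPred_eq, h, pts_mk, frobOrbit_infty] at ha
      simp at ha
    · rw [← Set.ncard_eq_toFinset_card _ hfin, deg,
        ← Set.ncard_image_of_injective _ (OnePoint.coe_injective)]
      congr 1
      ext Q
      induction Q using OnePoint.rec with
      | infty => simp [mem_pts_iff, eq_comm, h]
      | coe a => simp
  · intro a
    rw [hm, ← count_roots, roots_prod_X_sub_C]
    rw [Multiset.count_eq_of_nodup hfin.toFinset.nodup]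
    simp [mem_pts_iff, eq_comm]

/-- A polynomial whose order of vanishing at every finite point is prescribed by a divisor. -/
theorem exists_poly_of_divisor (D : ClosedPoint k →₀ ℕ) :
    ∃ B : k[X], B ≠ 0 ∧ B.natDegree + D (ClosedPoint.mk ∞) = divDeg D ∧
      ∀ a : AlgebraicClosure k, (B.map (algebraMap k (AlgebraicClosure k))).rootMultiplicity a =
        D (ClosedPoint.mk (a : P1bar k)) := by
  classical
  induction D using Finsupp.induction_linear with
  | zero => exact ⟨1, one_ne_zero, by simp [divDeg], fun a => by
      rw [Polynomial.map_one]; exact rootMultiplicity_C 1 a⟩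
  | add D D' h h' =>
    obtain ⟨B, hB, hd, hr⟩ := h
    obtain ⟨B', hB', hd', hr'⟩ := h'
    refine ⟨B * B', mul_ne_zero hB hB', ?_, fun a => ?_⟩
    · rw [divDeg_add, ← hd, ← hd', natDegree_mul hB hB', Finsupp.add_apply]
      ring
    · rw [Polynomial.map_mul, rootMultiplicity_mul, hr, hr', Finsupp.add_apply]
      exact mul_ne_zero (Polynomial.map_ne_zero hB) (Polynomial.map_ne_zero hB')
  | single o n =>
    obtain ⟨m, hm, hd, hr⟩ := o.exists_poly
    refine ⟨m ^ n, pow_ne_zero n hm, ?_, fun a => ?_⟩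
    · rw [natDegree_pow, hd, divDeg_single, Finsupp.single_apply]
      split_ifs with h
      · rw [h, ClosedPoint.deg_mk, frobOrbit_infty]; simp
      · simp
    · rw [Polynomial.map_pow, ← count_roots, roots_pow, Multiset.count_nsmul, count_roots, hr,
        Finsupp.single_apply]
      split_ifs <;> simp

theorem poleDiv_le_iff {D : ClosedPoint k →₀ ℕ} {f : RatFunc k} :
    poleDiv f ≤ D ↔ ∀ Q, poleOrder f Q ≤ D (ClosedPoint.mk Q) := by
  constructor
  · intro h Q
    rw [← poleDiv_mk]
    exact h _
  · intro h o
    obtain ⟨Q, rfl⟩ := ClosedPoint.mk_surjective o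
    rw [poleDiv_mk]
    exact h Q

/-- With `B` the common denominator that realizes the finite part of `D`, a function with poles
bounded by `D` is `A / B`. The bound at infinity reads `deg A ≤ deg B + D(∞)`, and the right side is
the degree of `D`. -/
theorem setOf_poleDiv_le_eq_image (D : ClosedPoint k →₀ ℕ) :
    ∃ B : k[X], B ≠ 0 ∧ {f : RatFunc k | poleDiv f ≤ D} =
      (fun A : k[X] => algebraMap k[X] (RatFunc k) A / algebraMap k[X] (RatFunc k) B) ''
        (degreeLT k (divDeg D + 1) : Set k[X]) := by
  obtain ⟨B, hB, hd, hr⟩ := exists_poly_of_divisor D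
  refine ⟨B, hB, ?_⟩
  ext f
  rw [Set.mem_ofPred_eq, poleDiv_le_iff]
  constructor
  · intro h
    rcases eq_or_ne f 0 with rfl | hf
    · exact ⟨0, Submodule.zero_mem _, by simp⟩
    have hdvd : f.denom ∣ B := by
      rw [← Polynomial.map_dvd_map' (algebraMap k (AlgebraicClosure k)),
        (IsAlgClosed.splits _).dvd_iff_roots_le_roots (Polynomial.map_ne_zero f.denom_ne_zero)
          (Polynomial.map_ne_zero hB)]
      classical
      rw [Multiset.le_iff_count]
      intro a
      rw [count_roots, count_roots, hr]
      exact h a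
    obtain ⟨c, hc⟩ := hdvd
    have hc0 : c ≠ 0 := by rintro rfl; exact hB (by simpa using hc)
    refine ⟨f.num * c, ?_, ?_⟩
    · rw [SetLike.mem_coe, mem_degreeLT]
      refine natDegree_lt_iff_degree_lt (mul_ne_zero (RatFunc.num_ne_zero hf) hc0) |>.1 ?_
      have h1 := h ∞
      rw [poleOrder_infty, RatFunc.intDegree] at h1
      rw [natDegree_mul (RatFunc.num_ne_zero hf) hc0]
      rw [hc, natDegree_mul f.denom_ne_zero hc0] at hd
      omega
    · dsimp only
      rw [hc, map_mul, map_mul, mul_div_mul_right _ _ (RatFunc.algebraMap_ne_zero hc0),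
        RatFunc.num_div_denom]
  · rintro ⟨A, hA, rfl⟩ Q
    rcases eq_or_ne A 0 with rfl | hA0
    · simp
    dsimp only
    rw [poleOrder_eq_toNat, ord_div hA0 hB]
    rw [SetLike.mem_coe, mem_degreeLT, ← natDegree_lt_iff_degree_lt hA0] at hA
    induction Q using OnePoint.rec with
    | infty =>
      rw [polyOrd_infty, polyOrd_infty]
      omega
    | coe a =>
      rw [polyOrd_some, polyOrd_some, hr]
      omega

/-- The Riemann-Roch space of an effective divisor on the projective line. -/
theorem finite_and_ncard_poleDiv_le (D : ClosedPoint k →₀ ℕ) :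
    {f : RatFunc k | poleDiv f ≤ D}.Finite ∧
    {f : RatFunc k | poleDiv f ≤ D}.ncard = Fintype.card k ^ (divDeg D + 1) := by
  obtain ⟨B, hB, h⟩ := setOf_poleDiv_le_eq_image D
  have hcard : Nat.card (degreeLT k (divDeg D + 1)) = Fintype.card k ^ (divDeg D + 1) := by
    rw [Nat.card_congr (degreeLTEquiv k (divDeg D + 1)).toEquiv, Nat.card_fun, Nat.card_fin,
      Nat.card_eq_fintype_card]
  have hfin : Finite (degreeLT k (divDeg D + 1)) :=
    Finite.of_equiv _ (degreeLTEquiv k (divDeg D + 1)).toEquiv.symm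
  rw [h]
  refine ⟨(Set.toFinite (degreeLT k (divDeg D + 1) : Set k[X])).image _, ?_⟩
  rw [Set.ncard_image_of_injective]
  · exact hcard
  · intro A A' hAA
    exact RatFunc.algebraMap_injective k
      ((div_left_inj' (RatFunc.algebraMap_ne_zero hB)).1 hAA)

/-- Induction on `U`: imposing the full pole order at a new point `P` removes the functions bounded
by `D - P`, a fraction `q ^ (-deg P)` of all, without touching the conditions at the other points.
The statement is for all `D` because the induction hypothesis is applied to `D` and to `D - P`. -/
theorem ncard_poleDiv_le_and_eq (U : Finset (ClosedPoint k)) :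
    ∀ D : ClosedPoint k →₀ ℕ, (∀ o ∈ U, D o ≠ 0) →
    ({f : RatFunc k | poleDiv f ≤ D ∧ ∀ o ∈ U, poleDiv f o = D o}.ncard : ℚ) =
      (Fintype.card k : ℚ) ^ (divDeg D + 1) * ∏ o ∈ U, (1 - ((Fintype.card k : ℚ) ^ o.deg)⁻¹) := by
  classical
  induction U using Finset.induction_on with
  | empty =>
    intro D _
    simp [(finite_and_ncard_poleDiv_le D).2]
  | insert P U hP ih =>
    intro D hD
    have hPD : Finsupp.single P 1 ≤ D := by
      rw [Finsupp.single_le_iff]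
      exact Nat.one_le_iff_ne_zero.2 (hD P (Finset.mem_insert_self _ _))
    obtain ⟨D', rfl⟩ := exists_add_of_le hPD
    have hne : ∀ o ∈ U, o ≠ P := fun o ho h => hP (h ▸ ho)
    have hval : ∀ o ∈ U, (Finsupp.single P 1 + D' : ClosedPoint k →₀ ℕ) o = D' o := by
      intro o ho
      simp [(hne o ho).symm]
    have hset : {f : RatFunc k | poleDiv f ≤ Finsupp.single P 1 + D' ∧
          ∀ o ∈ insert P U, poleDiv f o = (Finsupp.single P 1 + D' : ClosedPoint k →₀ ℕ) o} =
        {f : RatFunc k | poleDiv f ≤ Finsupp.single P 1 + D' ∧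
          ∀ o ∈ U, poleDiv f o = (Finsupp.single P 1 + D' : ClosedPoint k →₀ ℕ) o} \
        {f : RatFunc k | poleDiv f ≤ D' ∧ ∀ o ∈ U, poleDiv f o = D' o} := by
      ext f
      simp only [Set.mem_ofPred_eq, Set.mem_sdiff, Finset.forall_mem_insert]
      constructor
      · rintro ⟨h1, h2, h3⟩
        refine ⟨⟨h1, h3⟩, fun h => ?_⟩
        have := h.1 P
        rw [h2] at this
        simp at this
      · rintro ⟨⟨h1, h2⟩, h3⟩
        refine ⟨h1, ?_, h2⟩
        by_contra h4
        refine h3 ⟨fun o => ?_, fun o ho => (h2 o ho).trans (hval o ho)⟩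
        have h5 := h1 o
        rcases eq_or_ne o P with rfl | hoP
        · simp at h4 h5
          omega
        · simpa [Finsupp.single_apply, hoP.symm] using h5
    have hsub : {f : RatFunc k | poleDiv f ≤ D' ∧ ∀ o ∈ U, poleDiv f o = D' o} ⊆
        {f : RatFunc k | poleDiv f ≤ Finsupp.single P 1 + D' ∧
          ∀ o ∈ U, poleDiv f o = (Finsupp.single P 1 + D' : ClosedPoint k →₀ ℕ) o} := by
      rintro f ⟨h1, h2⟩
      exact ⟨h1.trans le_add_self, fun o ho => (h2 o ho).trans (hval o ho).symm⟩
    have hfin : {f : RatFunc k | poleDiv f ≤ Finsupp.single P 1 + D' ∧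
          ∀ o ∈ U, poleDiv f o = (Finsupp.single P 1 + D' : ClosedPoint k →₀ ℕ) o}.Finite :=
      (finite_and_ncard_poleDiv_le _).1.subset fun f hf => hf.1
    have hD1 : ∀ o ∈ U, (Finsupp.single P 1 + D' : ClosedPoint k →₀ ℕ) o ≠ 0 :=
      fun o ho => hD o (Finset.mem_insert_of_mem ho)
    rw [hset, Set.cast_ncard_sdiff hsub hfin, ih _ hD1,
      ih _ (fun o ho => by rw [← hval o ho]; exact hD1 o ho),
      Finset.prod_insert hP, divDeg_add, divDeg_single, one_mul]
    have hq : (Fintype.card k : ℚ) ≠ 0 := by simp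
    rw [add_assoc, pow_add]
    field_simp

/-- The number of rational functions with a given divisor of poles. -/
theorem ncard_poleDiv_eq (D : ClosedPoint k →₀ ℕ) :
    ({f : RatFunc k | poleDiv f = D}.ncard : ℚ) = (Fintype.card k : ℚ) ^ (divDeg D + 1) *
      ∏ o ∈ D.support, (1 - ((Fintype.card k : ℚ) ^ o.deg)⁻¹) := by
  rw [← ncard_poleDiv_le_and_eq D.support D (fun o ho => Finsupp.mem_support_iff.1 ho)]
  congr 2
  ext f
  constructor
  · rintro rfl
    exact ⟨le_rfl, fun _ _ => rfl⟩
  · rintro ⟨h1, h2⟩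
    ext o
    by_cases ho : o ∈ D.support
    · exact h2 o ho
    · have := h1 o
      rw [Finsupp.notMem_support_iff.1 ho] at this ⊢
      omega

theorem finite_poleDiv_eq (D : ClosedPoint k →₀ ℕ) : {f : RatFunc k | poleDiv f = D}.Finite :=
  (finite_and_ncard_poleDiv_le D).1.subset fun _ hf => le_of_eq hf

end Divisors

/-! ### Automorphisms of the rational function field -/

section Automorphisms

variable {k : Type u} [Field k]

theorem algHom_algebraMap_eq_aeval {L : Type*} [Field L] [Algebra k L] (σ : RatFunc k →ₐ[k] L)
    (A : k[X]) : σ (algebraMap k[X] (RatFunc k) A) = aeval (σ RatFunc.X) A := by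
  rw [aeval_algHom_apply, RatFunc.aeval_X_left_eq_algebraMap]

theorem ratFunc_algHom_ext {L : Type*} [Field L] [Algebra k L] {σ τ : RatFunc k →ₐ[k] L}
    (h : σ RatFunc.X = τ RatFunc.X) : σ = τ := by
  ext f
  rw [← RatFunc.num_div_denom f, map_div₀, map_div₀, algHom_algebraMap_eq_aeval,
    algHom_algebraMap_eq_aeval, algHom_algebraMap_eq_aeval, algHom_algebraMap_eq_aeval, h]

theorem algEquiv_X_injective :
    Function.Injective fun σ : RatFunc k ≃ₐ[k] RatFunc k => σ RatFunc.X := by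
  intro σ τ h
  have := ratFunc_algHom_ext (σ := (σ : RatFunc k →ₐ[k] RatFunc k)) (τ := τ) h
  ext f
  exact DFunLike.congr_fun this f

/-- The degree of `k(x)` over `k(f)` is the maximum of the degrees of numerator and denominator, so
`f` generates `k(x)` exactly when this maximum is 1. -/
theorem range_algEquiv_X :
    (Set.range fun σ : RatFunc k ≃ₐ[k] RatFunc k => σ RatFunc.X) =
      {f | max f.num.natDegree f.denom.natDegree = 1} := by
  ext f
  rw [Set.mem_ofPred_eq, ← RatFunc.finrank_eq_max_natDegree,
    IntermediateField.finrank_eq_one_iff_eq_top]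
  constructor
  · rintro ⟨σ, rfl⟩
    have := IntermediateField.adjoin_map k {RatFunc.X} (σ : RatFunc k →ₐ[k] RatFunc k)
    rw [RatFunc.adjoin_X, Set.image_singleton] at this
    refine this.symm.trans ?_
    rw [← AlgHom.fieldRange_eq_map]
    exact AlgHom.fieldRange_eq_top.2 σ.surjective
  · intro h
    have hf : ¬∃ c, f = RatFunc.C c := by
      intro hc
      have h1 := RatFunc.finrank_eq_max_natDegree f
      rw [(RatFunc.eq_C_iff f).1 hc |>.1, (RatFunc.eq_C_iff f).1 hc |>.2,
        IntermediateField.finrank_eq_one_iff_eq_top.2 h] at h1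
      simp at h1
    refine ⟨(RatFunc.algEquivOfTranscendental f (f.transcendental_of_ne_C hf)).trans
      ((IntermediateField.equivOfEq h).trans IntermediateField.topEquiv), ?_⟩
    exact RatFunc.algEquivOfTranscendental_X f _

end Automorphisms

/-! ### Automorphisms of `k(x)` as permutations of the projective line -/

section MoebiusAction

variable {k : Type u} [Field k]

theorem rootMultiplicity_linear_pow_mul {K : Type*} [Field K] {a β : K} (ha : a ≠ 0) (n : ℕ)
    {R : K[X]} (hR : R.eval β ≠ 0) :
    rootMultiplicity β ((C a * (X - C β)) ^ n * R) = n := by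
  have hR0 : R ≠ 0 := by rintro rfl; simp at hR
  have hC : (C a : K[X]) ^ n ≠ 0 := pow_ne_zero _ (C_ne_zero.2 ha)
  have hX : (X - C β : K[X]) ^ n ≠ 0 := pow_ne_zero _ (X_sub_C_ne_zero β)
  have hR1 : rootMultiplicity β R = 0 := rootMultiplicity_eq_zero hR
  rw [mul_pow, mul_assoc, rootMultiplicity_mul (mul_ne_zero hC (mul_ne_zero hX hR0)),
    rootMultiplicity_mul (mul_ne_zero hX hR0), rootMultiplicity_X_sub_C_pow, hR1, ← C_pow,
    rootMultiplicity_C]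
  simp

theorem exists_eq_pow_mul_eval_ne_zero {K : Type*} [Field K] {P : K[X]} (hP : P ≠ 0) (b : K) :
    ∃ R : K[X], P = (X - C b) ^ rootMultiplicity b P * R ∧ R.eval b ≠ 0 := by
  obtain ⟨R, h, hR⟩ := exists_eq_pow_rootMultiplicity_mul_and_not_dvd P hP b
  exact ⟨R, h, fun h0 => hR (dvd_iff_isRoot.2 h0)⟩

theorem rootMultiplicity_comp_linear {K : Type*} [Field K] {P : K[X]} (hP : P ≠ 0) {a : K}
    (ha : a ≠ 0) (b β : K) :
    rootMultiplicity β (P.comp (C a * X + C b)) = rootMultiplicity (a * β + b) P := by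
  obtain ⟨R, h, hR⟩ := exists_eq_pow_mul_eval_ne_zero hP (a * β + b)
  have h1 : (C a * X + C b) - C (a * β + b) = C a * (X - C β) := by
    rw [C_add, C_mul]; ring
  conv_lhs => rw [h]
  rw [mul_comp, pow_comp, sub_comp, X_comp, C_comp, h1, rootMultiplicity_linear_pow_mul ha]
  simpa [eval_comp] using hR

/-- Reversal is multiplicative and turns `X - b⁻¹` into `-b⁻¹ * (X - b)`; a cofactor that does not
vanish at `b⁻¹` reverses to one that does not vanish at `b`. -/
theorem rootMultiplicity_reverse {K : Type*} [Field K] {P : K[X]} (hP : P ≠ 0) {b : K}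
    (hb : b ≠ 0) : rootMultiplicity b P.reverse = rootMultiplicity b⁻¹ P := by
  obtain ⟨R, h, hR⟩ := exists_eq_pow_mul_eval_ne_zero hP b⁻¹
  have hpow : ∀ n : ℕ, ((X - C b⁻¹ : K[X]) ^ n).reverse = (C (-b⁻¹) * (X - C b)) ^ n := by
    intro n
    induction n with
    | zero => simpa using reverse_C (1 : K)
    | succ n ih =>
      rw [pow_succ, reverse_mul_of_domain, ih, pow_succ]
      congr 1
      have h2 : (X - C b⁻¹ : K[X]) = C 1 * X + C (-b⁻¹) := by simp [sub_eq_add_neg]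
      rw [h2, reverse_add_C, reverse_mul_X, reverse_C, natDegree_C_mul_X _ one_ne_zero]
      have h3 : (C b⁻¹ * C b : K[X]) = 1 := by rw [← C_mul, inv_mul_cancel₀ hb, C_1]
      rw [mul_sub, C_neg, neg_mul (C b⁻¹) (C b), h3, C_1]
      ring
  conv_lhs => rw [h]
  rw [reverse_mul_of_domain, hpow, rootMultiplicity_linear_pow_mul (neg_ne_zero.2 (inv_ne_zero hb))]
  intro h0
  have : Invertible (b⁻¹) := invertibleOfNonzero (inv_ne_zero hb)
  have h1 := eval₂_reverse_mul_pow (RingHom.id K) b⁻¹ R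
  rw [invOf_eq_inv, inv_inv] at h1
  apply hR
  change eval₂ (RingHom.id K) b⁻¹ R = 0
  rw [← h1]
  rw [eval] at h0
  rw [h0, zero_mul]

/-- An automorphism of `k(x)` comes from a permutation of the points of the projective line that
is compatible with Frobenius and orders of poles. -/
def IsGeometric [Fintype k] (σ : RatFunc k ≃ₐ[k] RatFunc k) : Prop :=
  ∃ γ : P1bar k ≃ P1bar k, (∀ Q, γ (frob k Q) = frob k (γ Q)) ∧
    ∀ f Q, poleOrder (σ f) Q = poleOrder f (γ Q)

/-- Orders are additive, so it is enough to compare them on numerators and denominators. -/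
theorem ord_algEquiv {σ : RatFunc k ≃ₐ[k] RatFunc k} {P Q : P1bar k}
    (h : ∀ A : k[X], A ≠ 0 → ord (σ (algebraMap k[X] (RatFunc k) A)) P = polyOrd A Q)
    (f : RatFunc k) : poleOrder (σ f) P = poleOrder f Q := by
  rcases eq_or_ne f 0 with rfl | hf
  · simp
  have hd := h _ f.denom_ne_zero
  have hn := h _ (RatFunc.num_ne_zero hf)
  have h1 : σ f * σ (algebraMap k[X] (RatFunc k) f.denom)
      = σ (algebraMap k[X] (RatFunc k) f.num) := by
    rw [← map_mul]
    congr 1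
    have h0 := RatFunc.num_div_denom f
    rw [div_eq_iff (RatFunc.algebraMap_ne_zero f.denom_ne_zero)] at h0
    exact h0.symm
  have h2 := ord_mul (f := σ f) (by simpa using hf)
    (g := σ (algebraMap k[X] (RatFunc k) f.denom))
    (by simpa using f.denom_ne_zero) P
  rw [h1, hd, hn] at h2
  have h3 : ord f Q = polyOrd f.num Q - polyOrd f.denom Q := rfl
  rw [poleOrder_eq_toNat, poleOrder_eq_toNat]
  omega

theorem ord_algebraMap {A : k[X]} (hA : A ≠ 0) (Q : P1bar k) :
    ord (algebraMap k[X] (RatFunc k) A) Q = polyOrd A Q := by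
  have := ord_div hA (one_ne_zero) Q
  rw [map_one, div_one] at this
  rw [this, sub_eq_self]
  induction Q using OnePoint.rec with
  | infty => simp [polyOrd_infty]
  | coe a => rw [polyOrd_some, Polynomial.map_one]; exact congrArg _ (rootMultiplicity_C 1 a)

variable [Fintype k]

theorem IsGeometric.mul {σ τ : RatFunc k ≃ₐ[k] RatFunc k} (hσ : IsGeometric σ)
    (hτ : IsGeometric τ) : IsGeometric (σ * τ) := by
  obtain ⟨γ, h1, h2⟩ := hσ
  obtain ⟨δ, h3, h4⟩ := hτ
  refine ⟨γ.trans δ, fun Q => ?_, fun f Q => ?_⟩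
  · simp [h1, h3]
  · rw [AlgEquiv.mul_apply, h2, h4]; rfl

theorem isGeometric_of_X_eq_linear {σ : RatFunc k ≃ₐ[k] RatFunc k} {a b : k} (ha : a ≠ 0)
    (h : σ RatFunc.X = algebraMap k[X] (RatFunc k) (C a * X + C b)) : IsGeometric σ := by
  have ha' : algebraMap k (AlgebraicClosure k) a ≠ 0 := by simpa using ha
  let ε : AlgebraicClosure k ≃ AlgebraicClosure k :=
    (Equiv.mulLeft₀ _ ha').trans (Equiv.addRight (algebraMap k (AlgebraicClosure k) b))
  have hε : ∀ x, ε x = algebraMap k (AlgebraicClosure k) a * x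
      + algebraMap k (AlgebraicClosure k) b := fun x => rfl
  let γ : P1bar k ≃ P1bar k := ε.optionCongr
  have hγ : ∀ x : AlgebraicClosure k, γ (x : P1bar k) = ((ε x : AlgebraicClosure k) : P1bar k) :=
    fun x => rfl
  have hγ' : γ ∞ = ∞ := rfl
  refine ⟨γ, fun Q => ?_, fun f Q => ord_algEquiv (fun A hA => ?_) f⟩
  · induction Q using OnePoint.rec with
    | infty => rfl
    | coe x =>
      rw [frob_some, hγ, hγ, frob_some, hε, hε]
      congr 1
      let φ := FiniteField.frobeniusAlgHom k (AlgebraicClosure k)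
      have := map_add φ (algebraMap k (AlgebraicClosure k) a * x)
        (algebraMap k (AlgebraicClosure k) b)
      rw [map_mul, AlgHom.commutes, AlgHom.commutes] at this
      exact this.symm
  · have hlin : (C a * X + C b : k[X]).natDegree = 1 := natDegree_linear ha
    have hcomp : A.comp (C a * X + C b) ≠ 0 := by
      intro h0
      rcases comp_eq_zero_iff.1 h0 with h0 | h0
      · exact hA h0
      · rw [h0.2, natDegree_C] at hlin
        exact zero_ne_one hlin
    have hσ : σ (algebraMap k[X] (RatFunc k) A)
        = algebraMap k[X] (RatFunc k) (A.comp (C a * X + C b)) := by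
      have := algHom_algebraMap_eq_aeval (σ : RatFunc k →ₐ[k] RatFunc k) A
      rw [AlgEquiv.coe_toAlgHom, h, aeval_algebraMap_apply] at this
      rw [this, comp_eq_aeval]
    rw [hσ, ord_algebraMap hcomp]
    induction Q using OnePoint.rec with
    | infty =>
      rw [hγ', polyOrd_infty, polyOrd_infty, natDegree_comp, hlin, mul_one]
    | coe x =>
      rw [hγ, polyOrd_some, polyOrd_some, Polynomial.map_comp]
      simp only [Polynomial.map_add, Polynomial.map_mul, map_C, map_X]
      rw [rootMultiplicity_comp_linear (Polynomial.map_ne_zero hA) ha', hε]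

theorem isGeometric_of_X_eq_inv {σ : RatFunc k ≃ₐ[k] RatFunc k}
    (h : σ RatFunc.X = RatFunc.X⁻¹) : IsGeometric σ := by
  classical
  let inv : P1bar k → P1bar k := fun Q => match Q with
    | ∞ => ((0 : AlgebraicClosure k) : P1bar k)
    | OnePoint.some x => if x = 0 then ∞ else ((x⁻¹ : AlgebraicClosure k) : P1bar k)
  have hinf : inv ∞ = ((0 : AlgebraicClosure k) : P1bar k) := rfl
  have hsome : ∀ x : AlgebraicClosure k, inv (x : P1bar k)
      = if x = 0 then ∞ else ((x⁻¹ : AlgebraicClosure k) : P1bar k) := fun x => rfl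
  have hzero : inv ((0 : AlgebraicClosure k) : P1bar k) = ∞ := by rw [hsome, if_pos rfl]
  have hinv : Function.Involutive inv := by
    intro Q
    induction Q using OnePoint.rec with
    | infty => rw [hinf, hzero]
    | coe x =>
      rcases eq_or_ne x 0 with rfl | hx
      · rw [hzero, hinf]
      · rw [hsome, if_neg hx, hsome, if_neg (inv_ne_zero hx), inv_inv]
  have hq : Fintype.card k ≠ 0 := Fintype.card_ne_zero
  refine ⟨hinv.toPerm, fun Q => ?_, fun f Q => ord_algEquiv (fun A hA => ?_) f⟩
  · change inv _ = frob k (inv _)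
    induction Q using OnePoint.rec with
    | infty => rw [frob_infty, hinf, frob_some, zero_pow hq]
    | coe x =>
      rcases eq_or_ne x 0 with rfl | hx
      · rw [frob_some, zero_pow hq, hzero, frob_infty]
      · rw [frob_some, hsome, hsome, if_neg hx, if_neg (pow_ne_zero _ hx), frob_some, inv_pow]
  · change _ = polyOrd A (inv Q)
    have hrev : A.reverse ≠ 0 := by simpa using hA
    -- Substituting `1/X` in `A` gives the reversed polynomial over `X ^ deg A`; zeros at the origin
    -- and degree at infinity are thereby exchanged.
    have hσ : σ (algebraMap k[X] (RatFunc k) A)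
        = algebraMap k[X] (RatFunc k) A.reverse /
          algebraMap k[X] (RatFunc k) (X ^ A.natDegree) := by
      have h1 := algHom_algebraMap_eq_aeval (σ : RatFunc k →ₐ[k] RatFunc k) A
      rw [AlgEquiv.coe_toAlgHom, h] at h1
      have : Invertible (RatFunc.X : RatFunc k)⁻¹ :=
        invertibleOfNonzero (inv_ne_zero RatFunc.X_ne_zero)
      have h2 := eval₂_reverse_mul_pow (algebraMap k (RatFunc k)) (RatFunc.X⁻¹) A
      rw [invOf_eq_inv, inv_inv] at h2
      rw [h1, aeval_def, ← h2, map_pow, RatFunc.algebraMap_X, inv_pow, ← div_eq_mul_inv,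
        ← RatFunc.aeval_X_left_eq_algebraMap, aeval_def]
    rw [hσ, ord_div hrev (pow_ne_zero _ X_ne_zero)]
    induction Q using OnePoint.rec with
    | infty =>
      rw [hinf, polyOrd_infty, polyOrd_infty, polyOrd_some, natDegree_X_pow, reverse_natDegree,
        rootMultiplicity_eq_natTrailingDegree, C_0, add_zero, comp_X]
      have h1 : (A.map (algebraMap k (AlgebraicClosure k))).natTrailingDegree
          = A.natTrailingDegree := by
        rw [natTrailingDegree, natTrailingDegree, trailingDegree, trailingDegree,
          support_map_of_injective _ (algebraMap k _).injective]
      have h2 := A.natTrailingDegree_le_natDegree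
      omega
    | coe x =>
      rw [polyOrd_some, polyOrd_some, Polynomial.map_pow, map_X]
      rcases eq_or_ne x 0 with rfl | hx
      · have h1 : rootMultiplicity 0 (A.reverse.map (algebraMap k (AlgebraicClosure k))) = 0 := by
          refine rootMultiplicity_eq_zero ?_
          rw [IsRoot.def, ← coeff_zero_eq_eval_zero, coeff_map, coeff_zero_reverse]
          simpa using hA
        have h2 := rootMultiplicity_X_sub_C_pow (0 : AlgebraicClosure k) A.natDegree
        rw [C_0, sub_zero] at h2
        rw [hzero, polyOrd_infty, h1, h2]
        simp
      · rw [hsome, if_neg hx, polyOrd_some, 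
          ← rootMultiplicity_reverse (Polynomial.map_ne_zero hA) hx, reverse,
          ← reflect_map, reverse, natDegree_map]
        have h1 : rootMultiplicity x (X ^ A.natDegree : (AlgebraicClosure k)[X]) = 0 := by
          refine rootMultiplicity_eq_zero ?_
          simp [hx]
        rw [h1]
        simp

/-- Every automorphism of `k(x)` over `k` comes from the projective line. -/
theorem isGeometric (σ : RatFunc k ≃ₐ[k] RatFunc k) : IsGeometric σ := by
  have exists_of : ∀ f : RatFunc k, max f.num.natDegree f.denom.natDegree = 1 →
      ∃ τ : RatFunc k ≃ₐ[k] RatFunc k, τ RatFunc.X = f := by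
    intro f hf
    have : f ∈ Set.range fun σ : RatFunc k ≃ₐ[k] RatFunc k => σ RatFunc.X := by
      rw [range_algEquiv_X]; exact hf
    exact this
  have exists_lin : ∀ a b : k, a ≠ 0 → ∃ τ : RatFunc k ≃ₐ[k] RatFunc k,
      τ RatFunc.X = algebraMap k[X] (RatFunc k) (C a * X + C b) := by
    intro a b ha
    refine exists_of _ ?_
    rw [RatFunc.num_algebraMap, RatFunc.denom_algebraMap, natDegree_linear ha]
    simp
  obtain ⟨ι, hι⟩ := exists_of RatFunc.X⁻¹ (by
    rw [natDegree_eq_of_degree_eq (degree_eq_degree_of_associated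
        (RatFunc.associated_num_inv RatFunc.X_ne_zero)),
      natDegree_eq_of_degree_eq (degree_eq_degree_of_associated
        (RatFunc.associated_denom_inv RatFunc.X_ne_zero))]
    simp)
  set f := σ RatFunc.X with hf
  have hmax : max f.num.natDegree f.denom.natDegree = 1 := by
    have : f ∈ Set.range fun σ : RatFunc k ≃ₐ[k] RatFunc k => σ RatFunc.X := ⟨σ, rfl⟩
    rwa [range_algEquiv_X] at this
  have hnum : f.num = C (f.num.coeff 1) * X + C (f.num.coeff 0) :=
    eq_X_add_C_of_natDegree_le_one (by omega)
  rcases Nat.eq_zero_or_pos f.denom.natDegree with h0 | h0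
  · have hden : f.denom = 1 := f.monic_denom.natDegree_eq_zero.1 h0
    have ha : f.num.coeff 1 ≠ 0 := by
      have : f.num.natDegree = 1 := by omega
      rw [← this]
      exact leadingCoeff_ne_zero.2 (by rintro h; simp [h] at this)
    refine isGeometric_of_X_eq_linear ha (b := f.num.coeff 0) ?_
    rw [← hnum, ← hf]
    conv_lhs => rw [← RatFunc.num_div_denom f, hden, map_one, div_one]
  -- Here `(aX + b) / (X + e) = a + (b - ae) / (X + e)`, so `σ` is composed of two affine
  -- substitutions and the inversion. Coprimality of numerator and denominator gives `b - ae ≠ 0`.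
  · set e := f.denom.coeff 0
    set a := f.num.coeff 1
    set b := f.num.coeff 0
    have hden : f.denom = X + C e := f.monic_denom.eq_X_add_C (by omega)
    have hc : b - a * e ≠ 0 := by
      intro hc
      have h1 : f.num = C a * f.denom := by
        rw [hnum, hden, sub_eq_zero.1 hc, C_mul]
        ring
      have h2 := f.isCoprime_num_denom
      rw [h1] at h2
      have h3 : IsUnit f.denom := h2.isUnit_of_dvd' (dvd_mul_left _ _) dvd_rfl
      rw [natDegree_eq_zero_of_isUnit h3] at h0
      exact lt_irrefl _ h0
    obtain ⟨τ₁, h₁⟩ := exists_lin 1 e one_ne_zero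
    obtain ⟨τ₂, h₂⟩ := exists_lin (b - a * e) a hc
    have hσ : σ = τ₁ * (ι * τ₂) := by
      apply algEquiv_X_injective
      dsimp only
      rw [AlgEquiv.mul_apply, AlgEquiv.mul_apply, ← hf, h₂, map_add, map_add, map_mul, map_mul,
        map_add, map_mul, RatFunc.algebraMap_X, hι, RatFunc.algebraMap_C, RatFunc.algebraMap_C,
        ← RatFunc.algebraMap_eq_C, AlgEquiv.commutes, AlgEquiv.commutes, AlgEquiv.commutes,
        AlgEquiv.commutes, map_inv₀, h₁]
      conv_lhs => rw [← RatFunc.num_div_denom f, hnum, hden]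
      have hX : algebraMap k[X] (RatFunc k) (X + C e) ≠ 0 := by
        rw [← hden]; exact RatFunc.algebraMap_ne_zero f.denom_ne_zero
      rw [C_1, one_mul, div_eq_iff hX, add_mul, mul_assoc, inv_mul_cancel₀ hX]
      simp only [map_add, map_mul, RatFunc.algebraMap_C, RatFunc.algebraMap_X, map_sub,
        RatFunc.algebraMap_eq_C]
      ring
    rw [hσ]
    exact (isGeometric_of_X_eq_linear one_ne_zero h₁).mul
      ((isGeometric_of_X_eq_inv hι).mul (isGeometric_of_X_eq_linear hc h₂))

end MoebiusAction

/-! ### The order of the automorphism group of `k(x)` -/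

section CountAutomorphisms

variable {k : Type u} [Field k] [Fintype k]

/-- The finite poles contribute the degree of the denominator, and the pole at infinity the excess
of the degree of the numerator, if any. -/
theorem divDeg_poleDiv (f : RatFunc k) :
    divDeg (poleDiv f) = max f.num.natDegree f.denom.natDegree := by
  classical
  obtain ⟨B, hB, hd, hr⟩ := exists_poly_of_divisor (poleDiv f)
  have hroots : (B.map (algebraMap k (AlgebraicClosure k))).roots
      = (f.denom.map (algebraMap k (AlgebraicClosure k))).roots := by
    ext a
    rw [count_roots, count_roots, hr, poleDiv_mk, poleOrder_some]
  have hdeg : B.natDegree = f.denom.natDegree := by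
    rw [← natDegree_map (algebraMap k (AlgebraicClosure k)),
      ← natDegree_map (p := f.denom) (algebraMap k (AlgebraicClosure k)),
      ← splits_iff_card_roots.1 (IsAlgClosed.splits _), hroots,
      splits_iff_card_roots.1 (IsAlgClosed.splits _)]
  rw [← hd, hdeg, poleDiv_mk, poleOrder_infty, RatFunc.intDegree]
  omega

theorem divDeg_eq_one_iff (D : ClosedPoint k →₀ ℕ) :
    divDeg D = 1 ↔ ∃ o : ClosedPoint k, o.deg = 1 ∧ D = Finsupp.single o 1 := by
  classical
  constructor
  · intro h
    have hD : D ≠ 0 := by rintro rfl; simp [divDeg] at h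
    obtain ⟨o, ho⟩ := Finsupp.ne_iff.1 hD
    rw [Finsupp.zero_apply] at ho
    obtain ⟨D', rfl⟩ := exists_add_of_le
      (Finsupp.single_le_iff.2 (Nat.one_le_iff_ne_zero.2 ho) : Finsupp.single o 1 ≤ D)
    rw [divDeg_add, divDeg_single, one_mul] at h
    have hpos := o.deg_pos
    refine ⟨o, by omega, ?_⟩
    have h0 : divDeg D' = 0 := by omega
    suffices D' = 0 by rw [this, add_zero]
    by_contra hne
    obtain ⟨P, hP⟩ := Finsupp.ne_iff.1 hne
    rw [Finsupp.zero_apply] at hP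
    have h1 := (Finset.sum_eq_zero_iff.1 h0) P (Finsupp.mem_support_iff.2 hP)
    rcases Nat.mul_eq_zero.1 h1 with h2 | h2
    · exact hP h2
    · exact P.deg_pos.ne' h2
  · rintro ⟨o, ho, rfl⟩
    rw [divDeg_single, ho]

/-- An automorphism is determined by the image of `X`, a function with a single simple pole at a
rational point. Each of the `q + 1` rational points is the pole of `q ^ 2 - q` such functions. -/
theorem finite_and_card_algEquiv : Finite (RatFunc k ≃ₐ[k] RatFunc k) ∧
    (Nat.card (RatFunc k ≃ₐ[k] RatFunc k) : ℚ)
      = (Fintype.card k : ℚ) ^ 3 - Fintype.card k := by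
  classical
  have hfin := ClosedPoint.finite_setOf_deg_eq (k := k) 1
  have hcount : hfin.toFinset.card = Fintype.card k + 1 := by
    rw [← Set.ncard_eq_toFinset_card _ hfin]; exact ClosedPoint.count_one
  have hset : (Set.range fun σ : RatFunc k ≃ₐ[k] RatFunc k => σ RatFunc.X) =
      ((hfin.toFinset.biUnion fun o => (finite_poleDiv_eq (Finsupp.single o 1)).toFinset :
        Finset (RatFunc k)) : Set (RatFunc k)) := by
    rw [range_algEquiv_X]
    ext f
    rw [Set.mem_ofPred_eq, ← divDeg_poleDiv, divDeg_eq_one_iff]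
    simp
  have hfinrange : (Set.range fun σ : RatFunc k ≃ₐ[k] RatFunc k => σ RatFunc.X).Finite := by
    rw [hset]; exact Finset.finite_toSet _
  refine ⟨Set.finite_range_iff algEquiv_X_injective |>.1 hfinrange, ?_⟩
  rw [← Set.ncard_univ, ← Set.ncard_image_of_injective _ algEquiv_X_injective, Set.image_univ, hset,
    Set.ncard_coe_finset, Finset.card_biUnion]
  · push_cast
    rw [Finset.sum_congr rfl (g := fun _ => (Fintype.card k : ℚ) ^ 2 - Fintype.card k)]
    · rw [Finset.sum_const, hcount, nsmul_eq_mul]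
      push_cast
      ring
    · intro o ho
      have ho' : o.deg = 1 := by simpa using ho
      have hq : (Fintype.card k : ℚ) ≠ 0 := by simp
      rw [← Set.ncard_eq_toFinset_card _ (finite_poleDiv_eq (Finsupp.single o 1)),
        ncard_poleDiv_eq, divDeg_single, Finsupp.support_single _ one_ne_zero,
        Finset.prod_singleton, ho']
      field_simp
  · intro o _ o' _ hne
    refine Finset.disjoint_left.2 fun f hf hf' => hne ?_
    rw [Set.Finite.mem_toFinset, Set.mem_ofPred_eq] at hf hf'
    exact (Finsupp.single_left_inj one_ne_zero).1 (hf.symm.trans hf')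

end CountAutomorphisms

/-! ### Counting divisors with prescribed labels -/

theorem finite_and_ncard_of_fibers {α β : Type*} {s : Set α} {t : Set β} (f : α → β) (c : ℚ)
    (ht : t.Finite) (hst : Set.MapsTo f s t)
    (hfin : ∀ b ∈ t, {a | a ∈ s ∧ f a = b}.Finite)
    (hc : ∀ b ∈ t, ({a | a ∈ s ∧ f a = b}.ncard : ℚ) = c) :
    s.Finite ∧ (s.ncard : ℚ) = t.ncard * c := by
  classical
  have hs : s.Finite := by
    refine (ht.biUnion hfin).subset fun a ha => ?_
    simp only [Set.mem_iUnion]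
    exact ⟨f a, hst ha, ha, rfl⟩
  refine ⟨hs, ?_⟩
  rw [Set.ncard_eq_toFinset_card _ hs, Set.ncard_eq_toFinset_card _ ht,
    Finset.card_eq_sum_card_fiberwise (f := f) (t := ht.toFinset)]
  · push_cast
    rw [Finset.sum_congr rfl (g := fun _ => c), Finset.sum_const, nsmul_eq_mul]
    intro b hb
    rw [← hc b (ht.mem_toFinset.1 hb), ← Set.ncard_coe_finset]
    congr 2
    ext a
    simp
  · intro a ha
    simpa using hst (by simpa using ha)

/-- Equal multisets of values mean fibres of equal size; bijections of the fibres are glued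
together. -/
theorem exists_equiv_of_map_univ_eq {α β γ : Type*} [Fintype α] [Fintype β] {f : α → γ}
    {g : β → γ} (h : Finset.univ.val.map f = Finset.univ.val.map g) :
    ∃ e : α ≃ β, ∀ a, g (e a) = f a := by
  classical
  have hc : ∀ c : γ, Nonempty ({a // f a = c} ≃ {b // g b = c}) := by
    intro c
    rw [← Fintype.card_eq, Fintype.card_subtype, Fintype.card_subtype]
    have := congrArg (Multiset.count c) h
    rw [Multiset.count_map, Multiset.count_map] at this
    simp only [Finset.card, Finset.filter_val]
    simpa only [eq_comm] using this
  exact ⟨Equiv.ofFiberEquiv fun c => (hc c).some, Equiv.ofFiberEquiv_map _⟩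

section Labels

variable {k : Type u} [Field k] [Fintype k]

/-- The splitting behaviour of a divisor. -/
noncomputable def divLabels (D : ClosedPoint k →₀ ℕ) : SplittingBehavior :=
  D.support.val.map fun o => (D o + 1, o.deg)

/-- A set of representatives of the orbits of poles maps bijectively onto the support of the pole
divisor. From here on only the divisor matters. -/
theorem polesHaveBehavior_iff {f : RatFunc k} {S : SplittingBehavior} :
    PolesHaveBehavior f S ↔ divLabels (poleDiv f) = S := by
  classical
  constructor
  · rintro ⟨T, h1, h2, rfl⟩
    have hsupp : (poleDiv f).support = T.image ClosedPoint.mk := by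
      ext o
      obtain ⟨Q, rfl⟩ := ClosedPoint.mk_surjective o
      rw [Finsupp.mem_support_iff, poleDiv_mk, Finset.mem_image]
      constructor
      · intro hQ
        obtain ⟨P, ⟨hP, hPQ⟩, -⟩ := h2 Q hQ
        exact ⟨P, hP, (ClosedPoint.mk_eq_mk_iff_mem.2 hPQ).symm⟩
      · rintro ⟨P, hP, hPQ⟩
        rw [← poleDiv_mk, ← hPQ, poleDiv_mk]
        exact h1 P hP
    have hinj : Set.InjOn (ClosedPoint.mk (k := k)) T := by
      intro P hP P' hP' h
      exact (h2 P (h1 P hP)).unique ⟨hP, mem_frobOrbit_self P⟩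
        ⟨hP', ClosedPoint.mk_eq_mk_iff_mem.1 h⟩
    rw [divLabels, hsupp, Finset.image_val_of_injOn hinj, Multiset.map_map]
    refine Multiset.map_congr rfl fun P _ => ?_
    rw [Function.comp_apply, poleDiv_mk, ClosedPoint.deg_mk]
  · rintro rfl
    have hrep : Function.Injective (ClosedPoint.rep (k := k)) :=
      Function.LeftInverse.injective ClosedPoint.mk_rep
    refine ⟨(poleDiv f).support.image ClosedPoint.rep, ?_, ?_, ?_⟩
    · intro P hP
      obtain ⟨o, ho, rfl⟩ := Finset.mem_image.1 hP
      exact Finsupp.mem_support_iff.1 ho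
    · intro Q hQ
      refine ⟨(ClosedPoint.mk Q).rep, ⟨Finset.mem_image_of_mem _ ?_, ?_⟩, ?_⟩
      · rwa [Finsupp.mem_support_iff, poleDiv_mk]
      · exact ClosedPoint.mk_eq_mk_iff_mem.1 (ClosedPoint.mk_rep _).symm
      · rintro P ⟨hP, hQP⟩
        obtain ⟨o, ho, rfl⟩ := Finset.mem_image.1 hP
        rw [ClosedPoint.mk_eq_mk_iff_mem.2 hQP, ClosedPoint.mk_rep]
    · rw [Finset.image_val_of_injOn hrep.injOn, Multiset.map_map, divLabels]
      refine Multiset.map_congr rfl fun o _ => ?_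
      rw [Function.comp_apply, ← poleDiv_apply, ← ClosedPoint.deg_mk, ClosedPoint.mk_rep]

theorem mem_divLabels {D : ClosedPoint k →₀ ℕ} {a : ℕ × ℕ} :
    a ∈ divLabels D ↔ ∃ o, D o ≠ 0 ∧ D o + 1 = a.1 ∧ o.deg = a.2 := by
  simp only [divLabels, Multiset.mem_map, Finset.mem_val, Finsupp.mem_support_iff, Prod.ext_iff]

theorem divDeg_eq_of_divLabels {D : ClosedPoint k →₀ ℕ} {S : SplittingBehavior}
    (h : divLabels D = S) : divDeg D = (S.map fun a => (a.1 - 1) * a.2).sum := by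
  subst h
  rw [divLabels, Multiset.map_map]
  rfl

theorem prod_support_eq_of_divLabels {D : ClosedPoint k →₀ ℕ} {S : SplittingBehavior}
    (h : divLabels D = S) (F : ℕ → ℚ) :
    ∏ o ∈ D.support, F o.deg = (S.map fun a => F a.2).prod := by
  subst h
  rw [divLabels, Multiset.map_map]
  rfl

variable (k) in
/-- Tuples of different closed points of prescribed degrees. -/
def pointTuples {n : ℕ} (d : Fin n → ℕ) : Set (Fin n → ClosedPoint k) :=
  {t | Function.Injective t ∧ ∀ i, (t i).deg = d i}

theorem finite_pointTuples {n : ℕ} (d : Fin n → ℕ) : (pointTuples k d).Finite :=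
  (Set.Finite.pi' fun i => ClosedPoint.finite_setOf_deg_eq (d i)).subset fun _ ht => ht.2

/-- The divisor with prescribed multiplicities at the points of a tuple. -/
noncomputable def tupleDiv {n : ℕ} (e : Fin n → ℕ) (t : Fin n → ClosedPoint k) :
    ClosedPoint k →₀ ℕ := ∑ i, Finsupp.single (t i) (e i)

theorem tupleDiv_apply {n : ℕ} (e : Fin n → ℕ) {t : Fin n → ClosedPoint k}
    (ht : Function.Injective t) (i : Fin n) : tupleDiv e t (t i) = e i := by
  classical
  rw [tupleDiv, Finsupp.finsetSum_apply, Finset.sum_eq_single i]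
  · simp
  · intro j _ hj
    rw [Finsupp.single_apply, if_neg fun h => hj (ht h)]
  · simp

theorem tupleDiv_apply_ne_zero_iff {n : ℕ} {e : Fin n → ℕ} (he : ∀ i, e i ≠ 0)
    {t : Fin n → ClosedPoint k} (ht : Function.Injective t) (o : ClosedPoint k) :
    tupleDiv e t o ≠ 0 ↔ o ∈ Set.range t := by
  classical
  constructor
  · intro h
    by_contra ho
    apply h
    rw [tupleDiv, Finsupp.finsetSum_apply]
    refine Finset.sum_eq_zero fun i _ => ?_
    rw [Finsupp.single_apply, if_neg fun h => ho ⟨i, h⟩]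
  · rintro ⟨i, rfl⟩
    rw [tupleDiv_apply e ht]
    exact he i

theorem divLabels_tupleDiv {n : ℕ} {s : Fin n → ℕ × ℕ} (hs : ∀ i, 2 ≤ (s i).1)
    {t : Fin n → ClosedPoint k} (ht : t ∈ pointTuples k fun i => (s i).2) :
    divLabels (tupleDiv (fun i => (s i).1 - 1) t) = Finset.univ.val.map s := by
  classical
  have he : ∀ i, (s i).1 - 1 ≠ 0 := fun i => by have := hs i; omega
  have hsupp : (tupleDiv (fun i => (s i).1 - 1) t).support = Finset.univ.image t := by
    ext o
    rw [Finsupp.mem_support_iff, tupleDiv_apply_ne_zero_iff he ht.1]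
    simp
  rw [divLabels, hsupp, Finset.image_val_of_injOn ht.1.injOn, Multiset.map_map]
  refine Multiset.map_congr rfl fun i _ => ?_
  have := hs i
  rw [Function.comp_apply, tupleDiv_apply _ ht.1, ht.2 i]
  ext
  · dsimp only; omega
  · rfl

theorem exists_tupleDiv_eq {n : ℕ} {s : Fin n → ℕ × ℕ} {D : ClosedPoint k →₀ ℕ}
    (hD : divLabels D = Finset.univ.val.map s) :
    ∃ t ∈ pointTuples k (fun i => (s i).2), tupleDiv (fun i => (s i).1 - 1) t = D := by
  classical
  have hD' : (Finset.univ : Finset D.support).val.map (fun o => (D o.1 + 1, o.1.deg))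
      = Finset.univ.val.map s := by
    rw [← hD, divLabels]
    conv_rhs => rw [← Finset.attach_map_val (s := D.support)]
    rw [Finset.map_val, Multiset.map_map]
    rfl
  obtain ⟨e, he⟩ := exists_equiv_of_map_univ_eq hD'
  have hinj : Function.Injective fun i => ((e.symm i : D.support) : ClosedPoint k) :=
    Subtype.val_injective.comp e.symm.injective
  have hv : ∀ i, s i = (D (e.symm i).1 + 1, (e.symm i).1.deg) := by
    intro i
    rw [← he (e.symm i), Equiv.apply_symm_apply]
  refine ⟨fun i => (e.symm i).1, ⟨hinj, fun i => (congrArg Prod.snd (hv i)).symm⟩, ?_⟩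
  have hpos : ∀ i, (s i).1 - 1 ≠ 0 := by
    intro i
    rw [hv i]
    exact Finsupp.mem_support_iff.1 (e.symm i).2
  ext o
  by_cases ho : o ∈ D.support
  · obtain ⟨i, hi⟩ := e.symm.surjective ⟨o, ho⟩
    have h1 := tupleDiv_apply (fun i => (s i).1 - 1) hinj i
    rw [hv i, hi] at h1
    simpa using h1
  · have h1 := (tupleDiv_apply_ne_zero_iff hpos hinj o).not.2 (by
      rintro ⟨i, rfl⟩
      exact ho (e.symm i).2)
    rw [not_not] at h1
    rw [h1, Finsupp.notMem_support_iff.1 ho]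

theorem finite_divLabels_eq (S : SplittingBehavior) :
    {D : ClosedPoint k →₀ ℕ | divLabels D = S}.Finite := by
  have hS : S = Finset.univ.val.map S.toList.get := by
    rw [Fin.univ_val_map, List.ofFn_get, Multiset.coe_toList]
  refine ((finite_pointTuples (k := k) fun i => (S.toList.get i).2).image
    (tupleDiv fun i => (S.toList.get i).1 - 1)).subset fun D hD => ?_
  rw [Set.mem_ofPred_eq, hS] at hD
  obtain ⟨t, ht, h⟩ := exists_tupleDiv_eq hD
  exact ⟨t, ht, h⟩

/-- Divisors with given labels are counted by tuples of points, up to the permutations that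
preserve the labels. -/
theorem ncard_pointTuples_eq {n : ℕ} {s : Fin n → ℕ × ℕ} (hs : ∀ i, 2 ≤ (s i).1) :
    ((pointTuples k fun i => (s i).2).ncard : ℚ) =
      {D : ClosedPoint k →₀ ℕ | divLabels D = Finset.univ.val.map s}.ncard *
        {σ : Equiv.Perm (Fin n) | ∀ i, s (σ i) = s i}.ncard := by
  have hpos : ∀ i, (s i).1 - 1 ≠ 0 := fun i => by have := hs i; omega
  refine (finite_and_ncard_of_fibers (tupleDiv fun i => (s i).1 - 1) _ (finite_divLabels_eq _)
    (fun t ht => divLabels_tupleDiv hs ht)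
    (fun D _ => (finite_pointTuples _).subset fun _ h => h.1) fun D hD => ?_).2
  obtain ⟨t₀, ht₀, rfl⟩ := exists_tupleDiv_eq hD
  -- Two tuples with the same divisor have the same points, hence differ by a unique permutation,
  -- which must preserve multiplicities and degrees.
  have himg : {t | t ∈ (pointTuples k fun i => (s i).2) ∧
      tupleDiv (fun i => (s i).1 - 1) t = tupleDiv (fun i => (s i).1 - 1) t₀} =
      (fun σ : Equiv.Perm (Fin n) => t₀ ∘ σ) '' {σ | ∀ i, s (σ i) = s i} := by
    ext t
    constructor
    · rintro ⟨ht, hDD⟩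
      have hr : ∀ i, ∃ j, t₀ j = t i := by
        intro i
        change t i ∈ Set.range t₀
        rw [← tupleDiv_apply_ne_zero_iff hpos ht₀.1, ← hDD, tupleDiv_apply_ne_zero_iff hpos ht.1]
        exact ⟨i, rfl⟩
      choose σ hσ using hr
      have hσi : Function.Injective σ := by
        intro i j hij
        apply ht.1
        rw [← hσ, ← hσ, hij]
      refine ⟨Equiv.ofBijective σ (Finite.injective_iff_bijective.1 hσi), fun i => ?_,
        funext hσ⟩
      rw [Equiv.ofBijective_apply]
      have h1 := tupleDiv_apply (fun i => (s i).1 - 1) ht.1 i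
      rw [hDD, ← hσ i, tupleDiv_apply _ ht₀.1] at h1
      have h2 := ht₀.2 (σ i)
      rw [hσ i, ht.2 i] at h2
      have := hs i
      have := hs (σ i)
      ext
      · omega
      · exact h2.symm
    · rintro ⟨σ, hσ, rfl⟩
      refine ⟨⟨ht₀.1.comp σ.injective, fun i => ?_⟩, ?_⟩
      · exact (ht₀.2 (σ i)).trans (congrArg Prod.snd (hσ i))
      · rw [tupleDiv, tupleDiv]
        conv_rhs => rw [← Equiv.sum_comp σ]
        refine Finset.sum_congr rfl fun i _ => ?_
        rw [hσ i]
        rfl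
  rw [himg, Set.ncard_image_of_injective]
  intro σ τ h
  ext i
  exact congrArg Fin.val (ht₀.1 (congrFun h i))

/-- The number of functions whose poles have a given splitting behaviour. -/
theorem finite_and_ncard_polesHaveBehavior (S : SplittingBehavior) :
    {f : RatFunc k | PolesHaveBehavior f S}.Finite ∧
    ({f : RatFunc k | PolesHaveBehavior f S}.ncard : ℚ) =
      {D : ClosedPoint k →₀ ℕ | divLabels D = S}.ncard *
        ((Fintype.card k : ℚ) ^ ((S.map fun a => (a.1 - 1) * a.2).sum + 1) *
          (S.map fun a => 1 - ((Fintype.card k : ℚ) ^ a.2)⁻¹).prod) := by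
  have hset : ∀ D : ClosedPoint k →₀ ℕ, divLabels D = S →
      {f : RatFunc k | f ∈ {f : RatFunc k | PolesHaveBehavior f S} ∧ poleDiv f = D}
        = {f : RatFunc k | poleDiv f = D} := by
    rintro D rfl
    ext f
    simp only [Set.mem_ofPred_eq, polesHaveBehavior_iff, and_iff_right_iff_imp]
    rintro rfl
    rfl
  refine finite_and_ncard_of_fibers poleDiv _ (finite_divLabels_eq S) (fun f hf => polesHaveBehavior_iff.1 hf) ?_ ?_
  · intro D hD
    rw [hset D hD]
    exact finite_poleDiv_eq D
  · intro D hD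
    rw [hset D hD, ncard_poleDiv_eq, divDeg_eq_of_divLabels hD,
      prod_support_eq_of_divLabels hD fun d => 1 - ((Fintype.card k : ℚ) ^ d)⁻¹]

end Labels

/-! ### Equations of Artin-Schreier curves in characteristic two -/

section Frames

variable {k : Type u} [Field k]

theorem mem_fixedField_zpowers_iff {F : Type*} [Field F] [Algebra k F] {ι : F ≃ₐ[k] F} {z : F} :
    z ∈ IntermediateField.fixedField (Subgroup.zpowers ι) ↔ ι z = z := by
  rw [IntermediateField.mem_fixedField_iff]
  refine ⟨fun h => h ι (Subgroup.mem_zpowers ι), fun h f hf => ?_⟩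
  have : Subgroup.zpowers ι ≤ MulAction.stabilizer (F ≃ₐ[k] F) z := by
    rw [Subgroup.zpowers_le]
    exact h
  exact this hf

/-- A parametrization of the fixed field of an automorphism by rational functions. -/
noncomputable def fixedFieldEquiv {F : Type*} [Field F] [Algebra k F] {ι : F ≃ₐ[k] F}
    (x : RatFunc k →ₐ[k] F) (h : ∀ z, ι z = z ↔ ∃ r, x r = z) :
    RatFunc k ≃ₐ[k] IntermediateField.fixedField (Subgroup.zpowers ι) :=
  AlgEquiv.ofBijective
    (x.codRestrict (IntermediateField.fixedField (Subgroup.zpowers ι)).toSubalgebra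
      fun r => mem_fixedField_zpowers_iff.2 ((h _).2 ⟨r, rfl⟩)) <| by
    constructor
    · intro r r' hr
      exact x.toRingHom.injective (congrArg Subtype.val hr)
    · rintro ⟨z, hz⟩
      obtain ⟨r, hr⟩ := (h z).1 (mem_fixedField_zpowers_iff.1 hz)
      exact ⟨r, Subtype.ext hr⟩

theorem coe_fixedFieldEquiv {F : Type*} [Field F] [Algebra k F] {ι : F ≃ₐ[k] F}
    (x : RatFunc k →ₐ[k] F) (h : ∀ z, ι z = z ↔ ∃ r, x r = z) (r : RatFunc k) :
    (fixedFieldEquiv x h r : F) = x r := rfl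

/-- A coordinate `x` on the quotient of the curve and a generator `y` of the function field with
`ι y = y + 1`. -/
@[ext]
structure Frame (C : Curve k 2) where
  /-- the coordinate on the quotient -/
  x : RatFunc k →ₐ[k] C.F
  mem_range : ∀ z, C.ι z = z ↔ ∃ r, x r = z
  /-- the Artin-Schreier generator -/
  y : C.F
  ι_y : C.ι y = y + 1

theorem charP_of_algebra (k : Type*) [Field k] [CharP k 2] (F : Type*) [Field F] [Algebra k F] :
    CharP F 2 := charP_of_injective_algebraMap' k 2

namespace Frame

variable {C C' : Curve k 2}

theorem ι_x (P : Frame C) (r : RatFunc k) : C.ι (P.x r) = P.x r := (P.mem_range _).2 ⟨r, rfl⟩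

theorem ι_ι (C : Curve k 2) (z : C.F) : C.ι (C.ι z) = z := by
  have h := pow_orderOf_eq_one C.ι
  rw [C.orderOf_ι, pow_two] at h
  exact DFunLike.congr_fun h z

theorem x_injective (P : Frame C) : Function.Injective P.x := P.x.toRingHom.injective

variable [CharP k 2]

theorem exists_func (P : Frame C) : ∃ r, P.x r = P.y ^ 2 - P.y := by
  have := charP_of_algebra k C.F
  rw [← P.mem_range, map_sub, map_pow, P.ι_y, CharTwo.add_sq]
  ring

/-- The function `f` in the equation `y ^ 2 - y = f(x)`. -/
noncomputable def func (P : Frame C) : RatFunc k := P.exists_func.choose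

theorem x_func (P : Frame C) : P.x P.func = P.y ^ 2 - P.y := P.exists_func.choose_spec

theorem func_eq {P : Frame C} {f : RatFunc k} (h : P.x f = P.y ^ 2 - P.y) : P.func = f :=
  P.x_injective (P.x_func.trans h.symm)

/-- The coordinates with respect to the basis `1, y` over the rational function field. -/
noncomputable def coords (P : Frame C) : RatFunc k × RatFunc k ≃ C.F :=
  Equiv.ofBijective (fun a => P.x a.1 + P.x a.2 * P.y) <| by
    have := charP_of_algebra k C.F
    constructor
    · rintro ⟨a, b⟩ ⟨a', b'⟩ h
      dsimp only at h
      have h1 := congrArg C.ι h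
      simp only [map_add, map_mul, P.ι_x, P.ι_y] at h1
      have hb : P.x b = P.x b' := by linear_combination h1 - h
      have ha : P.x a = P.x a' := by linear_combination h - hb * P.y
      rw [P.x_injective ha, P.x_injective hb]
    · intro z
      -- If `z = a + b y`, then `ι z = z + b`. In characteristic 2 this forces `b = ι z + z` and `a
      -- = z + b y`, and both are invariant under `ι`.
      obtain ⟨b, hb⟩ := (P.mem_range (C.ι z + z)).1 (by rw [map_add, ι_ι, add_comm])
      obtain ⟨a, ha⟩ := (P.mem_range (z + (C.ι z + z) * P.y)).1 (by
        rw [map_add, map_mul, map_add, ι_ι, P.ι_y]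
        linear_combination C.ι z * CharTwo.two_eq_zero (R := C.F))
      refine ⟨(a, b), ?_⟩
      dsimp only
      rw [ha, hb]
      linear_combination (C.ι z + z) * P.y * CharTwo.two_eq_zero (R := C.F)

theorem coords_apply (P : Frame C) (a b : RatFunc k) :
    P.coords (a, b) = P.x a + P.x b * P.y := rfl

theorem coords_mul (P : Frame C) (a b c d : RatFunc k) :
    P.coords (a, b) * P.coords (c, d) = P.coords (a * c + b * d * P.func, a * d + b * c + b * d) := by
  simp only [coords_apply, map_add, map_mul, P.x_func]
  ring

/-- The isomorphism between two curves with the same equation. -/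
noncomputable def iso (P : Frame C) (Q : Frame C') (h : P.func = Q.func) : C.F ≃ₐ[k] C'.F where
  toEquiv := P.coords.symm.trans Q.coords
  map_mul' z w := by
    obtain ⟨⟨a, b⟩, rfl⟩ := P.coords.surjective z
    obtain ⟨⟨c, d⟩, rfl⟩ := P.coords.surjective w
    change Q.coords (P.coords.symm _) = Q.coords (P.coords.symm _) * Q.coords (P.coords.symm _)
    rw [coords_mul]
    simp only [Equiv.symm_apply_apply]
    rw [coords_mul, h]
  map_add' z w := by
    obtain ⟨⟨a, b⟩, rfl⟩ := P.coords.surjective z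
    obtain ⟨⟨c, d⟩, rfl⟩ := P.coords.surjective w
    have : ∀ {C : Curve k 2} (P : Frame C), P.coords (a, b) + P.coords (c, d)
        = P.coords (a + c, b + d) := by
      intro C P
      simp only [coords_apply, map_add]
      ring
    change Q.coords (P.coords.symm _) = Q.coords (P.coords.symm _) + Q.coords (P.coords.symm _)
    rw [this]
    simp only [Equiv.symm_apply_apply]
    rw [this]
  commutes' c := by
    have : ∀ {C : Curve k 2} (P : Frame C), algebraMap k C.F c
        = P.coords (algebraMap k (RatFunc k) c, 0) := by
      intro C P
      rw [coords_apply, AlgHom.commutes, map_zero, zero_mul, add_zero]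
    change Q.coords (P.coords.symm _) = _
    rw [this P, this Q, Equiv.symm_apply_apply]

theorem iso_coords (P : Frame C) (Q : Frame C') (h : P.func = Q.func) (a : RatFunc k × RatFunc k) :
    P.iso Q h (P.coords a) = Q.coords a :=
  congrArg Q.coords (P.coords.symm_apply_apply a)

theorem iso_x (P : Frame C) (Q : Frame C') (h : P.func = Q.func) (r : RatFunc k) :
    P.iso Q h (P.x r) = Q.x r := by
  have := P.iso_coords Q h (r, 0)
  simpa [coords_apply] using this

theorem iso_y (P : Frame C) (Q : Frame C') (h : P.func = Q.func) : P.iso Q h P.y = Q.y := by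
  have := P.iso_coords Q h (0, 1)
  simpa [coords_apply] using this

theorem iso_ι (P : Frame C) (Q : Frame C') (h : P.func = Q.func) (z : C.F) :
    P.iso Q h (C.ι z) = C'.ι (P.iso Q h z) := by
  obtain ⟨⟨a, b⟩, rfl⟩ := P.coords.surjective z
  simp only [coords_apply, map_add, map_mul, ι_x, ι_y, iso_x, iso_y, map_one]

/-- Transport of a frame along an isomorphism. -/
noncomputable def map (P : Frame C) (φ : C.F ≃ₐ[k] C'.F) (hφ : ∀ z, φ (C.ι z) = C'.ι (φ z)) : Frame C' where
  x := (φ : C.F →ₐ[k] C'.F).comp P.x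
  mem_range z := by
    obtain ⟨w, rfl⟩ := φ.surjective z
    rw [← hφ, φ.injective.eq_iff, P.mem_range]
    exact exists_congr fun r => φ.injective.eq_iff.symm
  y := φ P.y
  ι_y := by rw [← hφ, P.ι_y, map_add, map_one]

theorem map_func (P : Frame C) (φ : C.F ≃ₐ[k] C'.F) (hφ : ∀ z, φ (C.ι z) = C'.ι (φ z)) :
    (P.map φ hφ).func = P.func := by
  apply func_eq
  change φ (P.x P.func) = φ P.y ^ 2 - φ P.y
  rw [P.x_func, map_sub, map_pow]

theorem isomorphic (P : Frame C) (Q : Frame C') (h : P.func = Q.func) : C.Isomorphic C' :=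
  ⟨P.iso Q h, P.iso_ι Q h⟩

theorem algEquiv_ext (P : Frame C) {φ ψ : C.F ≃ₐ[k] C'.F} (hx : ∀ r, φ (P.x r) = ψ (P.x r))
    (hy : φ P.y = ψ P.y) : φ = ψ := by
  ext z
  obtain ⟨⟨a, b⟩, rfl⟩ := P.coords.surjective z
  simp only [coords_apply, map_add, map_mul, hx, hy]

/-- Change of the coordinate on the projective line and of the generator. -/
noncomputable def change (P : Frame C) (σ : RatFunc k ≃ₐ[k] RatFunc k) (h : RatFunc k) : Frame C where
  x := P.x.comp (σ : RatFunc k →ₐ[k] RatFunc k)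
  mem_range z := by
    rw [P.mem_range]
    constructor
    · rintro ⟨r, rfl⟩
      exact ⟨σ.symm r, congrArg P.x (σ.apply_symm_apply r)⟩
    · rintro ⟨r, rfl⟩
      exact ⟨σ r, rfl⟩
  y := P.y + P.x (σ h)
  ι_y := by rw [map_add, P.ι_y, P.ι_x]; ring

/-- The new coordinate is the old one after `σ`, so the old equation is read through `σ⁻¹`. The
shift of `y` was taken at `σ h` so that it becomes `h` in the new coordinate. -/
theorem change_func (P : Frame C) (σ : RatFunc k ≃ₐ[k] RatFunc k) (h : RatFunc k) :
    (P.change σ h).func = σ.symm P.func + (h ^ 2 - h) := by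
  have := charP_of_algebra k C.F
  apply func_eq
  change P.x (σ (σ.symm P.func + (h ^ 2 - h))) = (P.y + P.x (σ h)) ^ 2 - (P.y + P.x (σ h))
  rw [map_add, σ.apply_symm_apply, map_add, P.x_func, CharTwo.add_sq, map_sub, map_sub, map_pow,
    map_pow]
  ring

-- Two coordinates parametrize the same fixed field, so they differ by an automorphism of `k(x)`;
-- two generators differ by an element fixed by `ι`. The frames are thus in bijection with the
-- changes of equation.
omit [CharP k 2] in
theorem change_bijective (P : Frame C) :
    Function.Bijective fun a : (RatFunc k ≃ₐ[k] RatFunc k) × RatFunc k => P.change a.1 a.2 := by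
  constructor
  · rintro ⟨σ, h⟩ ⟨τ, h'⟩ H
    have hx : ∀ r, P.x (σ r) = P.x (τ r) := fun r => DFunLike.congr_fun (congrArg Frame.x H) r
    have hy : P.y + P.x (σ h) = P.y + P.x (τ h') := congrArg Frame.y H
    have hστ : σ = τ := AlgEquiv.ext fun r => P.x_injective (hx r)
    subst hστ
    rw [σ.injective (P.x_injective (add_left_cancel hy))]
  · intro Q
    let σ : RatFunc k ≃ₐ[k] RatFunc k :=
      (fixedFieldEquiv Q.x Q.mem_range).trans (fixedFieldEquiv P.x P.mem_range).symm
    have hσ : ∀ r, P.x (σ r) = Q.x r := by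
      intro r
      rw [← coe_fixedFieldEquiv P.x P.mem_range, AlgEquiv.trans_apply, AlgEquiv.apply_symm_apply,
        coe_fixedFieldEquiv]
    obtain ⟨h, hh⟩ := (Q.mem_range (Q.y - P.y)).1 (by rw [map_sub, P.ι_y, Q.ι_y]; ring)
    refine ⟨(σ, h), Frame.ext (AlgHom.ext hσ) ?_⟩
    change P.y + P.x (σ h) = Q.y
    rw [hσ, hh]
    ring

end Frame

variable [CharP k 2]

/-- The functions on the projective line that have poles of odd order and the splitting
behaviour `S`. -/
def typeSet (k : Type u) [Field k] [Fintype k] (S : SplittingBehavior) : Set (RatFunc k) :=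
  {f | (∀ Q, poleOrder f Q ≠ 0 → (poleOrder f Q).Coprime 2) ∧ PolesHaveBehavior f S}

theorem hasType_iff [Fintype k] {C : Curve k 2} {S : SplittingBehavior} :
    C.HasType S ↔ ∃ P : Frame C, P.func ∈ typeSet k S := by
  constructor
  · rintro ⟨x, f, y, hy, hf, h1, h2⟩
    let P : Frame C :=
      { x := (IntermediateField.fixedField (Subgroup.zpowers C.ι)).val.comp x.toAlgHom
        mem_range := fun z => by
          rw [← mem_fixedField_zpowers_iff]
          constructor
          · intro hz
            exact ⟨x.symm ⟨z, hz⟩, congrArg Subtype.val (x.apply_symm_apply ⟨z, hz⟩)⟩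
          · rintro ⟨r, rfl⟩
            exact (x r).2
        y := y
        ι_y := hy }
    have hP : P.func = f := Frame.func_eq hf.symm
    exact ⟨P, by rw [hP]; exact ⟨h1, h2⟩⟩
  · rintro ⟨P, h1, h2⟩
    exact ⟨fixedFieldEquiv P.x P.mem_range, P.func, P.y, P.ι_y, by
      rw [coe_fixedFieldEquiv, P.x_func], h1, h2⟩

end Frames

/-! ### Existence of a curve with a given equation -/

section Model

variable {k : Type u} [Field k]

/-- The function has a pole of odd order. -/
def HasOddPole (f : RatFunc k) : Prop := ∃ Q, Odd (poleOrder f Q)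

/-- A constant does not affect the odd pole of `f`, while `h ^ 2 - h` has only poles of even order.
The case `c = 0` makes the model a field; general `c` excludes new constants in it. -/
theorem HasOddPole.ne {f : RatFunc k} (hf : HasOddPole f) (h : RatFunc k) (c : k) :
    f + RatFunc.C c ≠ h ^ 2 - h := by
  intro H
  obtain ⟨Q, hQ⟩ := hf
  have h1 := poleOrder_sq_sub_self h Q
  rw [← H, poleOrder_add_eq_left] at h1
  · rw [h1] at hQ
    exact Nat.not_odd_iff_even.2 (even_two_mul _) hQ
  · rw [poleOrder_C]
    exact hQ.pos

instance {f : RatFunc k} [hf : Fact (HasOddPole f)] : Fact (∀ r, r ^ 2 ≠ f + 1 * r) :=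
  ⟨fun r hr => hf.out.ne r 0 (by rw [map_zero, hr]; ring)⟩

theorem exists_C_of_isAlgebraic {a : RatFunc k} (ha : IsAlgebraic k a) : ∃ c, a = RatFunc.C c := by
  by_contra h
  exact a.transcendental_of_ne_C h ha

theorem star_algebraMap {f : RatFunc k} (r : RatFunc k) :
    star (algebraMap (RatFunc k) (QuadraticAlgebra (RatFunc k) f 1) r) = algebraMap _ _ r := by
  ext <;> simp

/-- The conjugation of the quadratic algebra as an algebra automorphism. -/
noncomputable def conj (f : RatFunc k) :
    QuadraticAlgebra (RatFunc k) f 1 ≃ₐ[k] QuadraticAlgebra (RatFunc k) f 1 :=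
  AlgEquiv.ofRingEquiv (f := starRingAut) fun c => by
    rw [IsScalarTower.algebraMap_apply k (RatFunc k), starRingAut_apply, star_algebraMap]

theorem conj_apply (f : RatFunc k) (z : QuadraticAlgebra (RatFunc k) f 1) : conj f z = star z := rfl

theorem star_eq_self_iff {f : RatFunc k} {z : QuadraticAlgebra (RatFunc k) f 1} :
    star z = z ↔ ∃ r, algebraMap (RatFunc k) (QuadraticAlgebra (RatFunc k) f 1) r = z := by
  constructor
  · intro h
    refine ⟨z.re, ?_⟩
    have := congrArg QuadraticAlgebra.re h
    rw [QuadraticAlgebra.re_star, one_mul, add_eq_left] at this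
    ext <;> simp [this]
  · rintro ⟨r, rfl⟩
    exact star_algebraMap r

variable [CharP k 2]

/-- The curve `y ^ 2 - y = f(x)`. -/
noncomputable def model (f : RatFunc k) [hf : Fact (HasOddPole f)] : Curve k 2 where
  F := QuadraticAlgebra (RatFunc k) f 1
  ι := conj f
  orderOf_ι := by
    have : Fact (Nat.Prime 2) := ⟨Nat.prime_two⟩
    refine orderOf_eq_prime ?_ ?_
    · ext z : 1
      rw [pow_two, AlgEquiv.mul_apply, conj_apply, conj_apply, star_star, AlgEquiv.one_apply]
    · intro h
      have h1 := congrArg QuadraticAlgebra.re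
        (DFunLike.congr_fun h (⟨0, 1⟩ : QuadraticAlgebra (RatFunc k) f 1))
      rw [conj_apply, QuadraticAlgebra.re_star, AlgEquiv.one_apply] at h1
      simp at h1
  rational_quotient :=
    ⟨fixedFieldEquiv (IsScalarTower.toAlgHom k (RatFunc k) (QuadraticAlgebra (RatFunc k) f 1))
      fun z => by rw [conj_apply, star_eq_self_iff]; rfl⟩
  exact_constants z hz := by
    -- The trace of `z`, which is `z.im` in characteristic 2, and the norm of `z` are algebraic
    -- elements of `k(x)`, hence constants `c` and `c'`.
    have hz' : IsAlgebraic k (star z) := hz.algHom (conj f).toAlgHom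
    have h2 : (2 : RatFunc k) = 0 := CharTwo.two_eq_zero
    have hinj : Function.Injective
        (algebraMap (RatFunc k) (QuadraticAlgebra (RatFunc k) f 1)) := RingHom.injective _
    have hsum : z + star z = algebraMap (RatFunc k) _ z.im := by
      ext
      · simp
        linear_combination z.re * h2
      · simp
    have hprod := QuadraticAlgebra.algebraMap_norm_eq_mul_star z
    obtain ⟨c, hc⟩ := exists_C_of_isAlgebraic
      ((isAlgebraic_algebraMap_iff hinj).1 (hsum ▸ hz.add hz'))
    obtain ⟨c', hc'⟩ := exists_C_of_isAlgebraic
      ((isAlgebraic_algebraMap_iff hinj).1 (hprod ▸ hz.mul hz'))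
    rw [QuadraticAlgebra.norm_def, hc] at hc'
    rcases eq_or_ne c 0 with rfl | hc0
    · rw [map_zero] at hc
      have hz1 : z = algebraMap (RatFunc k) (QuadraticAlgebra (RatFunc k) f 1) z.re := by
        ext <;> simp [hc]
      rw [hz1, isAlgebraic_algebraMap_iff hinj] at hz
      obtain ⟨d, hd⟩ := exists_C_of_isAlgebraic hz
      refine ⟨d, ?_⟩
      rw [hz1, hd]
      rfl
    · exfalso
      have hC : RatFunc.C c ≠ 0 := by simpa using hc0
      -- Dividing the norm equation `z.re ^ 2 + c * z.re - f * c ^ 2 = c'` by `c ^ 2` exhibits `f +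
      -- c' / c ^ 2` as `h ^ 2 - h` with `h = z.re / c`.
      refine hf.out.ne (z.re / RatFunc.C c) (c' / c ^ 2) ?_
      rw [map_div₀, map_pow, ← hc']
      field_simp
      linear_combination (f * RatFunc.C c ^ 2 - f * RatFunc.C c ^ 2) * h2 + z.re * RatFunc.C c * h2

/-- The tautological frame of the model curve. -/
noncomputable def modelFrame (f : RatFunc k) [hf : Fact (HasOddPole f)] : Frame (model f) where
  x := IsScalarTower.toAlgHom k (RatFunc k) (QuadraticAlgebra (RatFunc k) f 1)
  mem_range z := star_eq_self_iff
  y := (⟨0, 1⟩ : QuadraticAlgebra (RatFunc k) f 1)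
  ι_y := by
    change star (⟨0, 1⟩ : QuadraticAlgebra (RatFunc k) f 1) = ⟨0, 1⟩ + 1
    have : (-1 : RatFunc k) = 1 := CharTwo.neg_eq 1
    ext <;> simp [QuadraticAlgebra.re_one, QuadraticAlgebra.im_one, this]

theorem modelFrame_func (f : RatFunc k) [hf : Fact (HasOddPole f)] : (modelFrame f).func = f := by
  have h : algebraMap (RatFunc k) (QuadraticAlgebra (RatFunc k) f 1) f
      = (⟨0, 1⟩ : QuadraticAlgebra (RatFunc k) f 1) ^ 2 - ⟨0, 1⟩ := by
    ext <;> simp [pow_two]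
  exact Frame.func_eq h

end Model

/-! ### The mass as a number of functions -/

section Mass

variable {k : Type u} [Field k] [Fintype k]

/-- A permutation commuting with Frobenius carries orbits to orbits of the same size, so
representatives can be pulled back. -/
theorem polesHaveBehavior_of_equiv {f g : RatFunc k} {S : SplittingBehavior}
    {γ : P1bar k ≃ P1bar k} (hγ : ∀ Q, γ (frob k Q) = frob k (γ Q))
    (h : ∀ Q, poleOrder g Q = poleOrder f (γ Q)) (hf : PolesHaveBehavior f S) :
    PolesHaveBehavior g S := by
  have hit : ∀ n Q, γ ((frob k)^[n] Q) = (frob k)^[n] (γ Q) := fun n =>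
    Function.Semiconj.iterate_right (f := γ) hγ n
  have horb : ∀ Q, frobOrbit (γ Q) = γ '' frobOrbit Q := by
    intro Q
    rw [frobOrbit, frobOrbit, ← Set.range_comp]
    exact congrArg Set.range (funext fun n => (hit n Q).symm)
  obtain ⟨T, h1, h2, rfl⟩ := hf
  refine ⟨T.map γ.symm.toEmbedding, ?_, ?_, ?_⟩
  · intro P hP
    obtain ⟨P', hP', rfl⟩ := Finset.mem_map.1 hP
    rw [h]
    simpa using h1 P' hP'
  · intro Q hQ
    rw [h] at hQ
    obtain ⟨P, ⟨hP, hPQ⟩, huniq⟩ := h2 _ hQ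
    refine ⟨γ.symm P, ⟨Finset.mem_map_of_mem _ hP, ?_⟩, ?_⟩
    · have := horb (γ.symm P)
      rw [γ.apply_symm_apply] at this
      rw [this] at hPQ
      obtain ⟨R, hR, hRQ⟩ := hPQ
      rwa [← γ.injective hRQ]
    · rintro P' ⟨hP', hQP'⟩
      obtain ⟨R, hR, rfl⟩ := Finset.mem_map.1 hP'
      rw [← huniq R ⟨hR, ?_⟩]
      · rfl
      · have := horb (γ.symm R)
        rw [γ.apply_symm_apply] at this
        rw [this]
        exact ⟨Q, hQP', rfl⟩
  · rw [Finset.map_val, Multiset.map_map]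
    refine Multiset.map_congr rfl fun P _ => ?_
    have := horb (γ.symm P)
    rw [γ.apply_symm_apply] at this
    rw [Function.comp_apply, h, this, Set.ncard_image_of_injective _ γ.injective]
    simp

theorem algEquiv_mem_typeSet (σ : RatFunc k ≃ₐ[k] RatFunc k) {f : RatFunc k}
    {S : SplittingBehavior} (hf : f ∈ typeSet k S) : σ f ∈ typeSet k S := by
  obtain ⟨γ, h1, h2⟩ := isGeometric σ
  refine ⟨fun Q hQ => ?_, polesHaveBehavior_of_equiv h1 (h2 f) hf.2⟩
  rw [h2] at hQ ⊢
  exact hf.1 _ hQ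

/-- Half of a divisor, rounded down. -/
noncomputable def halfDiv (D : ClosedPoint k →₀ ℕ) : ClosedPoint k →₀ ℕ :=
  D.mapRange (· / 2) rfl

theorem divDeg_halfDiv {D : ClosedPoint k →₀ ℕ} {S : SplittingBehavior} (h : divLabels D = S) :
    divDeg (halfDiv D) = (S.map fun a => (a.1 - 1) / 2 * a.2).sum := by
  subst h
  rw [divLabels, Multiset.map_map, divDeg, halfDiv, Finsupp.sum_mapRange_index (by simp)]
  rfl

/-- Where `h` has a pole of more than half the order of `f`, the sum acquires a pole of even order,
which is forbidden. Otherwise, as the order of `f` at a pole is odd, the order of `h ^ 2 - h` is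
strictly smaller and no pole order changes. -/
theorem add_sq_sub_self_mem_typeSet_iff {f h : RatFunc k} {S : SplittingBehavior}
    (hf : f ∈ typeSet k S) :
    f + (h ^ 2 - h) ∈ typeSet k S ↔ poleDiv h ≤ halfDiv (poleDiv f) := by
  rw [poleDiv_le_iff]
  have hhalf : ∀ Q, halfDiv (poleDiv f) (ClosedPoint.mk Q) = poleOrder f Q / 2 := fun Q => by
    rw [halfDiv, Finsupp.mapRange_apply, poleDiv_mk]
  simp only [hhalf]
  constructor
  · intro hfh Q
    by_contra! hlt
    have h1 := poleOrder_sq_sub_self h Q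
    have h2 : poleOrder (f + (h ^ 2 - h)) Q = 2 * poleOrder h Q := by
      rw [add_comm, poleOrder_add_eq_left (by omega), h1]
    have h3 := hfh.1 Q (by omega)
    rw [h2, Nat.coprime_mul_iff_left] at h3
    exact absurd h3.1 (by decide)
  · intro hle
    have heq : ∀ Q, poleOrder (f + (h ^ 2 - h)) Q = poleOrder f Q := by
      intro Q
      have h1 := poleOrder_sq_sub_self h Q
      have h2 := hle Q
      rcases Nat.eq_zero_or_pos (poleOrder f Q) with h0 | h0
      · have := poleOrder_add_le f (h ^ 2 - h) Q
        omega
      · have h3 := Nat.coprime_two_right.1 (hf.1 Q h0.ne')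
        apply poleOrder_add_eq_left
        obtain ⟨m, hm⟩ := h3
        omega
    refine ⟨fun Q hQ => ?_, polesHaveBehavior_of_equiv (γ := Equiv.refl _) (fun _ => rfl) heq hf.2⟩
    rw [heq] at hQ ⊢
    exact hf.1 Q hQ

theorem hasOddPole_of_mem_typeSet {f : RatFunc k} {S : SplittingBehavior} (hS : S ≠ 0)
    (hf : f ∈ typeSet k S) : HasOddPole f := by
  have h := polesHaveBehavior_iff.1 hf.2
  obtain ⟨a, ha⟩ := Multiset.exists_mem_of_ne_zero hS
  rw [← h] at ha
  obtain ⟨o, ho, -, -⟩ := mem_divLabels.1 ha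
  rw [poleDiv_apply] at ho
  exact ⟨o.rep, Nat.coprime_two_right.1 (hf.1 _ ho)⟩

/-- The order of the group of changes of the equation that preserve the splitting behaviour. -/
noncomputable def changeCount (k : Type u) [Field k] [Fintype k] (S : SplittingBehavior) : ℚ :=
  Nat.card (RatFunc k ≃ₐ[k] RatFunc k) *
    (Fintype.card k : ℚ) ^ ((S.map fun a => (a.1 - 1) / 2 * a.2).sum + 1)

theorem changeCount_eq (S : SplittingBehavior) : changeCount k S =
    ((Fintype.card k : ℚ) ^ 3 - Fintype.card k) *
      (Fintype.card k : ℚ) ^ ((S.map fun a => (a.1 - 1) / 2 * a.2).sum + 1) := by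
  rw [changeCount, finite_and_card_algEquiv.2]

variable [CharP k 2]

/-- The frames whose equation has the given splitting behaviour. -/
def frameSet (C : Curve k 2) (S : SplittingBehavior) : Set (Frame C) :=
  {P | P.func ∈ typeSet k S}

/-- Starting from `P`, every `σ` is allowed, and for each `σ` the admissible `h` form the
Riemann-Roch space of half the pole divisor of `σ⁻¹ f`. Its size depends only on `S`, which `σ`
preserves. -/
theorem finite_and_ncard_frameSet {C : Curve k 2} {S : SplittingBehavior} {P : Frame C}
    (hP : P ∈ frameSet C S) :
    (frameSet C S).Finite ∧ ((frameSet C S).ncard : ℚ) = changeCount k S := by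
  have hset : frameSet C S = (fun a : (RatFunc k ≃ₐ[k] RatFunc k) × RatFunc k => P.change a.1 a.2) ''
      {a | poleDiv a.2 ≤ halfDiv (poleDiv (a.1.symm P.func))} := by
    ext Q
    obtain ⟨a, rfl⟩ := P.change_bijective.2 Q
    rw [P.change_bijective.1.mem_set_image, Set.mem_ofPred_eq,
      ← add_sq_sub_self_mem_typeSet_iff (algEquiv_mem_typeSet a.1.symm hP), frameSet,
      Set.mem_ofPred_eq, Frame.change_func]
  have hfinG := (finite_and_card_algEquiv (k := k)).1
  have hfib : ∀ σ : RatFunc k ≃ₐ[k] RatFunc k,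
      {a : (RatFunc k ≃ₐ[k] RatFunc k) × RatFunc k |
        a ∈ {a : (RatFunc k ≃ₐ[k] RatFunc k) × RatFunc k |
          poleDiv a.2 ≤ halfDiv (poleDiv (a.1.symm P.func))} ∧ a.1 = σ} =
      (fun h => (σ, h)) '' {h | poleDiv h ≤ halfDiv (poleDiv (σ.symm P.func))} := by
    intro σ
    ext ⟨τ, h⟩
    simp only [Set.mem_ofPred_eq, Set.mem_image, Prod.mk.injEq]
    constructor
    · rintro ⟨h1, rfl⟩
      exact ⟨h, h1, rfl, rfl⟩
    · rintro ⟨h, h1, rfl, rfl⟩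
      exact ⟨h1, rfl⟩
  have key := finite_and_ncard_of_fibers
    (s := {a : (RatFunc k ≃ₐ[k] RatFunc k) × RatFunc k |
          poleDiv a.2 ≤ halfDiv (poleDiv (a.1.symm P.func))})
    (t := Set.univ) Prod.fst
    ((Fintype.card k : ℚ) ^ ((S.map fun a => (a.1 - 1) / 2 * a.2).sum + 1))
    Set.finite_univ (fun _ _ => Set.mem_univ _)
    (fun σ _ => by
      rw [hfib]
      exact (finite_and_ncard_poleDiv_le _).1.image _)
    (fun σ _ => by
      rw [hfib, Set.ncard_image_of_injective _ (Prod.mk_right_injective σ),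
        (finite_and_ncard_poleDiv_le _).2, divDeg_halfDiv
          (polesHaveBehavior_iff.1 (algEquiv_mem_typeSet σ.symm hP).2)]
      push_cast
      rfl)
  rw [hset, Set.ncard_image_of_injective _ P.change_bijective.1]
  refine ⟨key.1.image _, ?_⟩
  rw [key.2, Set.ncard_univ]
  rfl

-- Two frames with the same equation differ by an automorphism of the curve commuting with `ι`, and
-- conversely.
omit [Fintype k] in
theorem setOf_func_eq {C : Curve k 2} (P : Frame C) :
    {Q : Frame C | Q.func = P.func} =
      Set.range fun σ : C.cent => P.map σ.1 (Curve.mem_cent.1 σ.2) := by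
  ext Q
  constructor
  · intro hQ
    have hQ' : P.func = Q.func := Eq.symm hQ
    refine ⟨⟨P.iso Q hQ', Curve.mem_cent.2 (P.iso_ι Q hQ')⟩, ?_⟩
    exact Frame.ext (AlgHom.ext (P.iso_x Q hQ')) (P.iso_y Q hQ')
  · rintro ⟨σ, rfl⟩
    exact P.map_func _ _

omit [Fintype k] in
theorem cent_map_injective {C : Curve k 2} (P : Frame C) :
    Function.Injective fun σ : C.cent => P.map σ.1 (Curve.mem_cent.1 σ.2) := by
  intro σ τ h
  refine Subtype.ext (P.algEquiv_ext (fun r => ?_) ?_)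
  · exact DFunLike.congr_fun (congrArg Frame.x h) r
  · exact congrArg Frame.y h

/-- The centralizer acts freely on the finite set of admissible frames. For an infinite centralizer
`Nat.card` would be 0 and the weight meaningless. -/
theorem finite_cent {C : Curve k 2} {S : SplittingBehavior} (hC : C.HasType S) :
    Finite C.cent := by
  obtain ⟨P, hP⟩ := hasType_iff.1 hC
  rw [← Set.finite_range_iff (cent_map_injective P), ← setOf_func_eq]
  refine (finite_and_ncard_frameSet hP).1.subset fun Q hQ => ?_
  rw [frameSet, Set.mem_ofPred_eq, (hQ : Q.func = P.func)]
  exact hP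

/-- Orbit counting: the admissible frames map onto the admissible equations of `C`, and each fibre
is a torsor under the centralizer. -/
theorem ncard_image_func_mul_card_cent {C : Curve k 2} {S : SplittingBehavior}
    (hC : C.HasType S) (hfin : (typeSet k S).Finite) :
    ((Frame.func '' frameSet C S).ncard : ℚ) * Nat.card C.cent = changeCount k S := by
  obtain ⟨P, hP⟩ := hasType_iff.1 hC
  rw [← (finite_and_ncard_frameSet hP).2]
  have hset : ∀ Q ∈ frameSet C S, {R | R ∈ frameSet C S ∧ R.func = Q.func}
      = {R : Frame C | R.func = Q.func} := by
    intro Q hQ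
    ext R
    refine and_iff_right_of_imp fun h => ?_
    rw [frameSet, Set.mem_ofPred_eq, (h : R.func = Q.func)]
    exact hQ
  refine (finite_and_ncard_of_fibers Frame.func _ (hfin.subset ?_) (Set.mapsTo_image _ _)
    ?_ ?_).2.symm
  · rintro _ ⟨Q, hQ, rfl⟩
    exact hQ
  · rintro _ ⟨Q, hQ, rfl⟩
    exact (finite_and_ncard_frameSet hP).1.subset fun R hR => hR.1
  · rintro _ ⟨Q, hQ, rfl⟩
    rw [hset Q hQ, setOf_func_eq, ← Set.image_univ,
      Set.ncard_image_of_injective _ (cent_map_injective Q), Set.ncard_univ]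

/-- The isomorphism class of the curve with a given equation. -/
noncomputable def classOf {S : SplittingBehavior} (hS : S ≠ 0) (f : typeSet k S) :
    IsoClass k 2 S :=
  haveI : Fact (HasOddPole f.1) := ⟨hasOddPole_of_mem_typeSet hS f.2⟩
  Quotient.mk _ ⟨model f.1, hasType_iff.2 ⟨modelFrame f.1, by rw [modelFrame_func]; exact f.2⟩⟩

/-- An isomorphism carries the tautological frame of the model to a frame of `C` with the same
equation; conversely, curves with a common equation are isomorphic. -/
theorem classOf_eq_iff {S : SplittingBehavior} (hS : S ≠ 0) (f : typeSet k S)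
    (C : {C : Curve k 2 // C.HasType S}) :
    classOf hS f = (Quotient.mk _ C : IsoClass k 2 S) ↔ f.1 ∈ Frame.func '' frameSet C.1 S := by
  have : Fact (HasOddPole f.1) := ⟨hasOddPole_of_mem_typeSet hS f.2⟩
  have h : classOf hS f = (Quotient.mk _ C : IsoClass k 2 S) ↔ (model f.1).Isomorphic C.1 :=
    Quotient.eq (r := Curve.isoSetoid k 2 S)
  rw [h]
  constructor
  · rintro ⟨φ, hφ⟩
    have hfunc : ((modelFrame f.1).map φ hφ).func = f.1 := by
      rw [Frame.map_func, modelFrame_func]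
    refine ⟨(modelFrame f.1).map φ hφ, ?_, hfunc⟩
    rw [frameSet, Set.mem_ofPred_eq, hfunc]
    exact f.2
  · rintro ⟨P, -, hP⟩
    exact (modelFrame f.1).isomorphic P ((modelFrame_func f.1).trans hP.symm)

theorem classOf_surjective {S : SplittingBehavior} (hS : S ≠ 0) :
    Function.Surjective (classOf (k := k) hS) := by
  intro c
  induction c using Quotient.inductionOn with
  | _ C =>
    obtain ⟨P, hP⟩ := hasType_iff.1 C.2
    exact ⟨⟨P.func, hP⟩, (classOf_eq_iff hS _ C).2 ⟨P, hP, rfl⟩⟩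

theorem finite_isoClass {S : SplittingBehavior} (hS : S ≠ 0) (hfin : (typeSet k S).Finite) :
    Finite (IsoClass k 2 S) := by
  have := hfin.to_subtype
  exact Finite.of_surjective _ (classOf_surjective hS)

/-- The mass counts the equations with the given splitting behaviour. -/
theorem mass_mul_changeCount {S : SplittingBehavior} (hS : S ≠ 0)
    (hfin : (typeSet k S).Finite) :
    mass k 2 S * changeCount k S = (typeSet k S).ncard := by
  classical
  have := finite_isoClass hS hfin
  have := hfin.to_subtype
  have := Fintype.ofFinite (IsoClass k 2 S)
  have := Fintype.ofFinite (typeSet k S)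
  have hcard : (typeSet k S).ncard = (Finset.univ : Finset (typeSet k S)).card := by
    rw [Finset.card_univ, ← Nat.card_eq_fintype_card]
    rfl
  rw [mass, finsum_eq_sum_of_fintype, Finset.sum_mul, hcard,
    Finset.card_eq_sum_card_fiberwise (f := classOf hS) (t := Finset.univ) (by simp)]
  push_cast
  refine Finset.sum_congr rfl fun c _ => ?_
  induction c using Quotient.inductionOn with
  | _ C =>
    -- The class of `C` contributes `changeCount` divided by the order of its centralizer, which is
    -- the number of equations of `C`. Finiteness of the centralizer allows the division.
    have hfc := finite_cent C.2
    have h1 := ncard_image_func_mul_card_cent C.2 hfin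
    have hpos : (Nat.card C.1.cent : ℚ) ≠ 0 := by exact_mod_cast Nat.card_pos.ne'
    have h2 : (Finset.univ.filter fun f : typeSet k S =>
        classOf hS f = (Quotient.mk _ C : IsoClass k 2 S)).card
        = (Frame.func '' frameSet C.1 S).ncard := by
      rw [← Set.ncard_coe_finset, ← Set.ncard_image_of_injective _ Subtype.val_injective]
      congr 1
      ext f
      simp only [Finset.coe_filter, Finset.mem_univ, true_and, classOf_eq_iff]
      constructor
      · rintro ⟨g, hg, rfl⟩
        exact hg
      · rintro ⟨P, hP, rfl⟩
        exact ⟨⟨P.func, hP⟩, ⟨P, hP, rfl⟩, rfl⟩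
    refine Eq.trans ?_ (congrArg (Nat.cast (R := ℚ)) h2.symm)
    change (Nat.card C.1.cent : ℚ)⁻¹ * changeCount k S = _
    rw [← h1]
    field_simp

end Mass

/-! ### The mass for four branch points -/

section TupleCounts

variable {k : Type u} [Field k] [Fintype k]

theorem ncard_pointTuples_zero (d : Fin 0 → ℕ) : (pointTuples k d).ncard = 1 := by
  rw [Set.ncard_eq_one]
  refine ⟨Fin.elim0, ?_⟩
  ext t
  simp only [Set.mem_singleton_iff]
  constructor
  · intro _
    exact Subsingleton.elim _ _
  · intro _
    exact ⟨fun i => i.elim0, fun i => i.elim0⟩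

/-- Once the other points are chosen, the first one only has to avoid those among them that have its
degree. -/
theorem ncard_pointTuples_succ {n : ℕ} (d : Fin (n + 1) → ℕ) :
    ((pointTuples k d).ncard : ℚ) = (pointTuples k (Fin.tail d)).ncard *
      ((ClosedPoint.count k (d 0) : ℚ) - (Finset.univ.filter fun i => Fin.tail d i = d 0).card) := by
  classical
  refine (finite_and_ncard_of_fibers Fin.tail _ (finite_pointTuples _) ?_
    (fun _ _ => (finite_pointTuples d).subset fun _ h => h.1) ?_).2
  · rintro t ⟨h1, h2⟩
    exact ⟨h1.comp (Fin.succ_injective n), fun i => h2 i.succ⟩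
  · rintro t ⟨h1, h2⟩
    have hsub : t '' {i | Fin.tail d i = d 0} ⊆ {o : ClosedPoint k | o.deg = d 0} := by
      rintro _ ⟨i, hi, rfl⟩
      exact (h2 i).trans hi
    have hset : {s : Fin (n + 1) → ClosedPoint k | s ∈ pointTuples k d ∧ Fin.tail s = t} =
        (fun o => (Fin.cons o t : Fin (n + 1) → ClosedPoint k)) ''
          ({o : ClosedPoint k | o.deg = d 0} \ t '' {i | Fin.tail d i = d 0}) := by
      ext s
      constructor
      · rintro ⟨⟨h3, h4⟩, rfl⟩
        refine ⟨s 0, ⟨h4 0, ?_⟩, Fin.cons_self_tail s⟩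
        rintro ⟨i, -, hi⟩
        exact Fin.succ_ne_zero i (h3 hi)
      · rintro ⟨o, ⟨ho, hot⟩, rfl⟩
        refine ⟨⟨?_, fun i => ?_⟩, Fin.tail_cons _ _⟩
        · rw [Fin.cons_injective_iff]
          refine ⟨?_, h1⟩
          rintro ⟨i, rfl⟩
          exact hot ⟨i, (h2 i).symm.trans ho, rfl⟩
        · refine Fin.cases ?_ (fun i => ?_) i
          · exact ho
          · exact h2 i
    have hinj : Function.Injective fun o => (Fin.cons o t : Fin (n + 1) → ClosedPoint k) :=
      fun o o' h => congrFun h 0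
    rw [hset, Set.ncard_image_of_injective _ hinj,
      Set.cast_ncard_sdiff hsub (ClosedPoint.finite_setOf_deg_eq _),
      Set.ncard_image_of_injective _ h1, ← Set.ncard_coe_finset]
    congr 3
    simp

theorem ncard_pointTuples_single (a : ℕ) :
    ((pointTuples k ![a]).ncard : ℚ) = ClosedPoint.count k a := by
  rw [ncard_pointTuples_succ, ncard_pointTuples_zero]
  simp

theorem ncard_pointTuples_pair (a b : ℕ) :
    ((pointTuples k ![a, b]).ncard : ℚ) =
      ClosedPoint.count k b * (ClosedPoint.count k a - if b = a then 1 else 0) := by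
  have h : Fin.tail ![a, b] = ![b] := rfl
  rw [ncard_pointTuples_succ, h, ncard_pointTuples_single, Finset.card_filter]
  simp

theorem ncard_pointTuples_triple (a b c : ℕ) :
    ((pointTuples k ![a, b, c]).ncard : ℚ) =
      ClosedPoint.count k c * (ClosedPoint.count k b - if c = b then 1 else 0) *
        (ClosedPoint.count k a - ((if b = a then 1 else 0) + if c = a then 1 else 0)) := by
  have h : Fin.tail ![a, b, c] = ![b, c] := rfl
  rw [ncard_pointTuples_succ, h, ncard_pointTuples_pair, Finset.card_filter, Fin.sum_univ_two,
    Nat.cast_add, Nat.cast_ite, Nat.cast_ite, Nat.cast_one, Nat.cast_zero]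
  rfl

end TupleCounts

/-! ### The mass in terms of tuples of closed points -/

section MassFormula

variable {k : Type u} [Field k] [Fintype k]

theorem typeSet_subset (S : SplittingBehavior) :
    typeSet k S ⊆ {f : RatFunc k | PolesHaveBehavior f S} := fun _ hf => hf.2

theorem finite_typeSet (S : SplittingBehavior) : (typeSet k S).Finite :=
  (finite_and_ncard_polesHaveBehavior S).1.subset (typeSet_subset S)

/-- Even labels `ε` already force the pole orders `ε - 1` to be odd. -/
theorem typeSet_eq {S : SplittingBehavior} (hS : ∀ a ∈ S, Even a.1) :
    typeSet k S = {f : RatFunc k | PolesHaveBehavior f S} := by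
  refine (typeSet_subset S).antisymm fun f hf => ⟨fun Q hQ => ?_, hf⟩
  have h := polesHaveBehavior_iff.1 hf
  have hmem : (poleOrder f Q + 1, (ClosedPoint.mk Q).deg) ∈ S := by
    rw [← h, mem_divLabels]
    exact ⟨ClosedPoint.mk Q, by rwa [poleDiv_mk], by rw [poleDiv_mk], rfl⟩
  have := hS _ hmem
  rw [Nat.coprime_two_right]
  exact Nat.not_even_iff_odd.1 (Nat.even_add_one.1 this)

/-- Each geometric pole contributes `e = ⌊e/2⌋ + (e - 1 - ⌊e/2⌋) + 1`; as `e ≥ 1`, no subtraction is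
truncated. The final 1s add up to the number of geometric branch points. -/
theorem sum_degrees_eq {S : SplittingBehavior} (hS : ∀ a ∈ S, 2 ≤ a.1) :
    (S.map fun a => (a.1 - 1) * a.2).sum = (S.map fun a => (a.1 - 1) / 2 * a.2).sum +
      exponentE 2 S.ramificationData + S.ramificationData.card := by
  induction S using Multiset.induction_on with
  | empty => simp [SplittingBehavior.ramificationData, exponentE]
  | cons a S ih =>
    have h1 := ih fun b hb => hS b (Multiset.mem_cons_of_mem hb)
    have h2 := hS a (Multiset.mem_cons_self a S)
    have h3 : SplittingBehavior.ramificationData (a ::ₘ S)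
        = Multiset.replicate a.2 a.1 + SplittingBehavior.ramificationData S :=
      Multiset.cons_bind _ _ _
    have h4 : (a.1 - 1) = (a.1 - 1) / 2 + ((a.1 - 1) - 1 - (a.1 - 1) / 2) + 1 := by omega
    have h5 : (a.1 - 1) * a.2 = (a.1 - 1) / 2 * a.2 + a.2 * ((a.1 - 1) - 1 - (a.1 - 1) / 2)
        + a.2 := by
      conv_lhs => rw [h4]
      ring
    rw [Multiset.map_cons, Multiset.sum_cons, Multiset.map_cons, Multiset.sum_cons, h1, h3,
      Multiset.card_add, Multiset.card_replicate, h5]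
    simp only [exponentE, Multiset.map_add, Multiset.sum_add, Multiset.map_replicate,
      Multiset.sum_replicate, smul_eq_mul]
    ring

variable [CharP k 2]

/-- The mass in terms of the number of tuples of closed points of the given degrees. -/
theorem mass_mul_eq {n : ℕ} {s : Fin n → ℕ × ℕ} {S : SplittingBehavior}
    (hS : S = Finset.univ.val.map s) (hS0 : S ≠ 0) (hs : ∀ a ∈ S, 2 ≤ a.1 ∧ Even a.1) :
    mass k 2 S * {σ : Equiv.Perm (Fin n) | ∀ i, s (σ i) = s i}.ncard *
        ((Fintype.card k : ℚ) ^ 3 - Fintype.card k) =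
      (pointTuples k fun i => (s i).2).ncard *
        (Fintype.card k : ℚ) ^ (exponentE 2 S.ramificationData + S.ramificationData.card) *
        (S.map fun a => 1 - ((Fintype.card k : ℚ) ^ a.2)⁻¹).prod := by
  have h1 := mass_mul_changeCount (k := k) hS0 (finite_typeSet S)
  have h2 : ∀ i, 2 ≤ (s i).1 := fun i => (hs _ (by
    rw [hS]; exact Multiset.mem_map_of_mem s (Finset.mem_univ i))).1
  rw [typeSet_eq fun a ha => (hs a ha).2, (finite_and_ncard_polesHaveBehavior S).2,
    sum_degrees_eq fun a ha => (hs a ha).1, changeCount_eq, add_assoc _ _ (Multiset.card _),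
    add_right_comm, pow_add] at h1
  -- The size of the space of admissible `h` divides the number of functions with a given pole
  -- divisor, and this common power of `q` cancels.
  have hq : (Fintype.card k : ℚ) ^ ((S.map fun a => (a.1 - 1) / 2 * a.2).sum + 1) ≠ 0 :=
    pow_ne_zero _ (by simp)
  have h3 : mass k 2 S * ((Fintype.card k : ℚ) ^ 3 - Fintype.card k) =
      {D : ClosedPoint k →₀ ℕ | divLabels D = S}.ncard *
        (Fintype.card k : ℚ) ^ (exponentE 2 S.ramificationData + S.ramificationData.card) *
        (S.map fun a => 1 - ((Fintype.card k : ℚ) ^ a.2)⁻¹).prod := by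
    refine mul_right_cancel₀ hq ?_
    linear_combination h1
  rw [ncard_pointTuples_eq h2, ← hS, mul_right_comm, h3]
  ring

end MassFormula

/-! ### Symmetries of the labels -/

section LabelSymmetries

theorem ncard_perm_eq_one {n : ℕ} {α : Type*} {s : Fin n → α} (hs : Function.Injective s) :
    {σ : Equiv.Perm (Fin n) | ∀ i, s (σ i) = s i}.ncard = 1 := by
  rw [Set.ncard_eq_one]
  refine ⟨1, ?_⟩
  ext σ
  rw [Set.mem_singleton_iff]
  constructor
  · intro h
    ext i
    rw [hs (h i), Equiv.Perm.one_apply]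
  · rintro rfl i
    rfl

theorem ncard_perm_pair {α : Type*} (a : α) :
    {σ : Equiv.Perm (Fin 2) | ∀ i, ![a, a] (σ i) = ![a, a] i}.ncard = 2 := by
  have h : ∀ i, ![a, a] i = a := by intro i; fin_cases i <;> rfl
  have : {σ : Equiv.Perm (Fin 2) | ∀ i, ![a, a] (σ i) = ![a, a] i} = Set.univ := by
    ext σ
    simp [h]
  rw [this, Set.ncard_univ, Nat.card_eq_fintype_card, Fintype.card_perm, Fintype.card_fin]
  rfl

/-- The label `b` occurs only at index 2, so that index is fixed and only the swap of the other two
remains. -/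
theorem ncard_perm_pair_single {α : Type*} {a b : α} (hab : a ≠ b) :
    {σ : Equiv.Perm (Fin 3) | ∀ i, ![a, a, b] (σ i) = ![a, a, b] i}.ncard = 2 := by
  have h2 : ∀ i : Fin 3, ![a, a, b] i = b ↔ i = 2 := by
    intro i; fin_cases i <;> simp [hab]
  have hσ : ∀ σ : Equiv.Perm (Fin 3), σ 2 = 2 → σ = 1 ∨ σ = Equiv.swap 0 1 := by decide
  have : {σ : Equiv.Perm (Fin 3) | ∀ i, ![a, a, b] (σ i) = ![a, a, b] i}
      = {1, Equiv.swap 0 1} := by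
    ext σ
    constructor
    · intro h
      exact hσ σ ((h2 _).1 ((h 2).trans rfl))
    · rintro (rfl | rfl) i
      · rfl
      · fin_cases i <;> rfl
  rw [this, Set.ncard_pair (by decide)]

end LabelSymmetries

end ArtinSchreier

/-! ### The non-split types with four branch points -/

theorem mainTheorem9 (k : Type u) [Field k] [Fintype k] [CharP k 2]
    (R : Multiset ℕ) (S : ArtinSchreier.SplittingBehavior)
    (hRS : S.ramificationData = R) (hR : R.card = 4) (hpos : ∀ ε ∈ R, 0 < ε)
    (heven : ∀ ε ∈ R, Even ε) (q : ℚ) (hq : q = Fintype.card k) (E : ℕ)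
    (hE : E = ArtinSchreier.exponentE 2 R) :
    -- the sum defining the mass is a finite sum of reciprocals of orders of finite groups
    (Finite (ArtinSchreier.IsoClass k 2 S) ∧
      ∀ C : ArtinSchreier.Curve k 2, C.HasType S → Finite C.cent) ∧
    -- split/quadratic
    (∀ ε₁ ε₂ ε₃ : ℕ, S = {(ε₁, 1), (ε₂, 1), (ε₃, 2)} → ε₁ ≠ ε₂ →
      ArtinSchreier.mass k 2 S = (q - 1) ^ 2 * (q ^ 2 - 1) * q ^ (E + 1) / 2) ∧
    (∀ ε₁ ε₃ : ℕ, S = {(ε₁, 1), (ε₁, 1), (ε₃, 2)} →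
      ArtinSchreier.mass k 2 S = (q - 1) ^ 2 * (q ^ 2 - 1) * q ^ (E + 1) / 4) ∧
    -- quadratic
    (∀ ε₁ : ℕ, S = {(ε₁, 2), (ε₁, 2)} →
      ArtinSchreier.mass k 2 S = (q ^ 2 - 1) ^ 2 * q ^ E * (q - 2) / 8) ∧
    (∀ ε₁ ε₂ : ℕ, S = {(ε₁, 2), (ε₂, 2)} → ε₁ ≠ ε₂ →
      ArtinSchreier.mass k 2 S = (q ^ 2 - 1) ^ 2 * q ^ E * (q - 2) / 4) ∧
    -- cubic
    (∀ ε₁ ε₂ : ℕ, S = {(ε₁, 1), (ε₂, 3)} →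
      ArtinSchreier.mass k 2 S = (q - 1) * (q ^ 3 - 1) * q ^ E * (q + 1) / 3) ∧
    -- quartic
    (∀ ε₁ : ℕ, S = {(ε₁, 4)} →
      ArtinSchreier.mass k 2 S = (q ^ 4 - 1) * q ^ (E + 1) / 4) := by
  open ArtinSchreier in
  have hS0 : S ≠ 0 := by
    rintro rfl
    rw [← hRS] at hR
    simp [SplittingBehavior.ramificationData] at hR
  -- An entry of `S` of size 0 leaves no trace in `R`, so the conditions on `R` only constrain
  -- entries of nonzero size.
  have hmem : ∀ a ∈ S, a.2 ≠ 0 → 2 ≤ a.1 ∧ Even a.1 := by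
    intro a ha ha2
    have haR : a.1 ∈ R := by
      rw [← hRS, SplittingBehavior.ramificationData, Multiset.mem_bind]
      exact ⟨a, ha, Multiset.mem_replicate.2 ⟨ha2, rfl⟩⟩
    have h1 := hpos _ haR
    have h2 := heven _ haR
    obtain ⟨m, hm⟩ := h2
    exact ⟨by omega, ⟨m, hm⟩⟩
  have hq1 : 1 < q := by rw [hq]; exact_mod_cast Fintype.one_lt_card (α := k)
  have hq0 : q ≠ 0 := by linarith
  have hG : q ^ 3 - q ≠ 0 := by
    have : q ^ 3 - q = q * (q - 1) * (q + 1) := by ring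
    rw [this]
    exact mul_ne_zero (mul_ne_zero hq0 (by linarith)) (by linarith)
  have hc1 : (ClosedPoint.count k 1 : ℚ) = q + 1 := by
    rw [hq, ClosedPoint.count_one]; push_cast; rfl
  have hc2 : (ClosedPoint.count k 2 : ℚ) = (q ^ 2 - q) / 2 := by
    have : (2 * ClosedPoint.count k 2 + Fintype.card k : ℚ) = (Fintype.card k : ℚ) ^ 2 := by
      exact_mod_cast ClosedPoint.count_two (k := k)
    rw [hq]; linarith
  have hc3 : (ClosedPoint.count k 3 : ℚ) = (q ^ 3 - q) / 3 := by
    have : (3 * ClosedPoint.count k 3 + Fintype.card k : ℚ) = (Fintype.card k : ℚ) ^ 3 := by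
      exact_mod_cast ClosedPoint.count_three (k := k)
    rw [hq]; linarith
  have hc4 : (ClosedPoint.count k 4 : ℚ) = (q ^ 4 - q ^ 2) / 4 := by
    have : (4 * ClosedPoint.count k 4 + (Fintype.card k : ℚ) ^ 2 : ℚ)
        = (Fintype.card k : ℚ) ^ 4 := by
      exact_mod_cast ClosedPoint.count_four (k := k)
    rw [hq]; linarith
  -- The degrees add up to 4, so `q ^ 4` clears the denominators of the product and `M` is the
  -- product of the `q ^ d - 1`. Each tuple count below is a multiple of `q ^ 3 - q`, which then
  -- cancels.
  have key : ∀ {n : ℕ} {s : Fin n → ℕ × ℕ} {M : ℚ}, S = Finset.univ.val.map s →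
      (∀ a ∈ S, a.2 ≠ 0) → q ^ 4 * (S.map fun a => 1 - (q ^ a.2)⁻¹).prod = M →
      mass k 2 S * {σ : Equiv.Perm (Fin n) | ∀ i, s (σ i) = s i}.ncard * (q ^ 3 - q) =
        (pointTuples k fun i => (s i).2).ncard * q ^ E * M := by
    intro n s M hS hd hM
    have := mass_mul_eq (k := k) hS hS0 fun a ha => hmem a ha (hd a ha)
    rw [hRS, ← hE, hR, ← hq] at this
    rw [this, ← hM, pow_add]
    ring
  refine ⟨⟨finite_isoClass hS0 (finite_typeSet S), fun C hC => finite_cent hC⟩,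
    ?_, ?_, ?_, ?_, ?_, ?_⟩
  · intro ε₁ ε₂ ε₃ hS hne
    have h := key (M := (q - 1) ^ 2 * (q ^ 2 - 1))
      (s := ![(ε₁, 1), (ε₂, 1), (ε₃, 2)]) hS (by rw [hS]; simp) (by
        rw [hS]
        simp only [Multiset.insert_eq_cons, Multiset.map_cons, Multiset.map_singleton,
          Multiset.prod_cons, Multiset.prod_singleton]
        field_simp)
    have hinj : Function.Injective ![(ε₁, 1), (ε₂, 1), (ε₃, 2)] := by
      intro i j hij
      fin_cases i <;> fin_cases j <;> simp_all
    have hd : (fun i => (![(ε₁, 1), (ε₂, 1), (ε₃, 2)] i).2) = ![1, 1, 2] := by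
      ext i; fin_cases i <;> rfl
    -- The tuple count is `(q + 1) * q * (q ^ 2 - q) / 2 = (q ^ 3 - q) * q / 2`, the source of the
    -- extra factor `q`.
    rw [ncard_perm_eq_one hinj, hd, ncard_pointTuples_triple, hc1, hc2] at h
    norm_num at h
    refine mul_right_cancel₀ hG ?_
    linear_combination h
  · intro ε₁ ε₃ hS
    have h := key (M := (q - 1) ^ 2 * (q ^ 2 - 1))
      (s := ![(ε₁, 1), (ε₁, 1), (ε₃, 2)]) hS (by rw [hS]; simp) (by
        rw [hS]
        simp only [Multiset.insert_eq_cons, Multiset.map_cons, Multiset.map_singleton,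
          Multiset.prod_cons, Multiset.prod_singleton]
        field_simp)
    have hd : (fun i => (![(ε₁, 1), (ε₁, 1), (ε₃, 2)] i).2) = ![1, 1, 2] := by
      ext i; fin_cases i <;> rfl
    rw [ncard_perm_pair_single (by simp), hd, ncard_pointTuples_triple, hc1, hc2] at h
    norm_num at h
    refine mul_right_cancel₀ hG ?_
    -- The swap of the two rational points with equal labels halves the previous value.
    linear_combination h / 2
  · intro ε₁ hS
    have h := key (M := (q ^ 2 - 1) ^ 2)
      (s := ![(ε₁, 2), (ε₁, 2)]) hS (by rw [hS]; simp) (by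
        rw [hS]
        simp only [Multiset.insert_eq_cons, Multiset.map_cons, Multiset.map_singleton,
          Multiset.prod_cons, Multiset.prod_singleton]
        field_simp)
    have hd : (fun i => (![(ε₁, 2), (ε₁, 2)] i).2) = ![2, 2] := by
      ext i; fin_cases i <;> rfl
    -- With `N = (q ^ 2 - q) / 2` points of degree 2, the ordered pairs number `N * (N - 1) = (q ^ 3
    -- - q) * (q - 2) / 4`; this gives the factor `q - 2`.
    rw [ncard_perm_pair, hd, ncard_pointTuples_pair, hc2] at h
    norm_num at h
    refine mul_right_cancel₀ hG ?_
    linear_combination h / 2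
  · intro ε₁ ε₂ hS hne
    have h := key (M := (q ^ 2 - 1) ^ 2)
      (s := ![(ε₁, 2), (ε₂, 2)]) hS (by rw [hS]; simp) (by
        rw [hS]
        simp only [Multiset.insert_eq_cons, Multiset.map_cons, Multiset.map_singleton,
          Multiset.prod_cons, Multiset.prod_singleton]
        field_simp)
    have hinj : Function.Injective ![(ε₁, 2), (ε₂, 2)] := by
      intro i j hij
      fin_cases i <;> fin_cases j <;> simp_all
    have hd : (fun i => (![(ε₁, 2), (ε₂, 2)] i).2) = ![2, 2] := by
      ext i; fin_cases i <;> rfl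
    rw [ncard_perm_eq_one hinj, hd, ncard_pointTuples_pair, hc2] at h
    norm_num at h
    refine mul_right_cancel₀ hG ?_
    linear_combination h
  · intro ε₁ ε₂ hS
    have h := key (M := (q - 1) * (q ^ 3 - 1))
      (s := ![(ε₁, 1), (ε₂, 3)]) hS (by rw [hS]; simp) (by
        rw [hS]
        simp only [Multiset.insert_eq_cons, Multiset.map_cons, Multiset.map_singleton,
          Multiset.prod_cons, Multiset.prod_singleton]
        field_simp)
    have hinj : Function.Injective ![(ε₁, 1), (ε₂, 3)] := by
      intro i j hij
      fin_cases i <;> fin_cases j <;> simp_all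
    have hd : (fun i => (![(ε₁, 1), (ε₂, 3)] i).2) = ![1, 3] := by
      ext i; fin_cases i <;> rfl
    -- Points of different degrees are automatically distinct, so the count is `(q + 1) * (q ^ 3 -
    -- q) / 3`.
    rw [ncard_perm_eq_one hinj, hd, ncard_pointTuples_pair, hc1, hc3] at h
    norm_num at h
    refine mul_right_cancel₀ hG ?_
    linear_combination h
  · intro ε₁ hS
    have h := key (M := q ^ 4 - 1)
      (s := ![(ε₁, 4)]) hS (by rw [hS]; simp) (by
        rw [hS]
        simp only [Multiset.map_singleton, Multiset.prod_singleton]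
        field_simp)
    have hinj : Function.Injective ![(ε₁, 4)] := Function.injective_of_subsingleton _
    have hd : (fun i => (![(ε₁, 4)] i).2) = ![4] := by
      ext i; fin_cases i; rfl
    -- The number of quartic points is `(q ^ 4 - q ^ 2) / 4 = (q ^ 3 - q) * q / 4`.
    rw [ncard_perm_eq_one hinj, hd, ncard_pointTuples_single, hc4] at h
    norm_num at h
    refine mul_right_cancel₀ hG ?_
    linear_combination h
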